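/- **Setting.** Let $\Omega$ be a Polish space with its Borel $\sigma$-algebra and let $\mathcal P$ be a weakly compact set of Borel probability measures (priors) on $\Omega$. For Borel $X:\Omega\to\mathbb R$ put $c_{2,\mathcal P}(X)=\sup_{P\in\mathcal P}E^P[X^2]^{1/2}$. Let $L^2(\mathcal P)$ be the $c_{2,\mathcal P}$-closure of $C_b(\Omega)$ in the Borel functions, modulo $c_{2,\mathcal P}$-null elements. Write $X\ge 0$ if $P(X\ge 0)=1$ for every $P\in\mathcal P$, and call $X$ *strictly positive* if moreover $P(X>0)>0$ for some $P\in\mathcal P$. Let $k(\mathcal P)$ be the weakly closed convex hull of $\mathcal P$. **Prices.** $\mathfrak P(\mathcal P)$ is the set of functionals $\Psi:L^2(\mathcal P)\to\mathbb R$ of the form $\Psi(X)=\sup_{P\in A}E^P[Z_PX]$ with $\emptyset\ne A\subseteq k(\mathcal P)$ and $Z_P\in L^2(P)_+$ for $P\in A$; $\mathfrak P(\mathcal P)_{++}$ is the set of those $\Psi\in\mathfrak P(\mathcal P)$ with $\Psi(X)>0$ for every strictly positive $X$. **Price system.** For each $P\in\mathcal P$ let $M_P\subseteq L^2(P)$ be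 a closed subspace and $\pi_P:M_P\to\mathbb R$ a linear functional; the elements of $M_P$ are read as random variables through a linear space $V_P$ of Borel functions whose $P$-classes are exactly the elements of $M_P$. A consolidation $\Gamma$ is a nonempty set of probability measures (weightings) on $\mathcal P$; it sends a family of functionals $(\Pi_P)_{P\in\mathcal P}$ on $L^2(\mathcal P)$ to $\Gamma((\Pi_P))(X)=\sup_{\mu\in\Gamma}\int_{\mathcal P}\Pi_P(X)\,d\mu(P)$, whenever these integrals exist and the supremum is finite for all $X\in L^2(\mathcal P)$. The set of relevant priors $\Gamma(\mathcal P)$ is the union of the supports of the $\mu\in\Gamma$. The $\Gamma$-marketed space $\mathbb M(\Gamma)$ is the $c_{2,\mathcal P}$-closure in $L^2(\mathcal P)$ of the set of claims in $L^2(\mathcal P)$ that lie in the linear hull of the $V_P$, $P\in\Gamma(\mathcal P)$. A functional $\psi:\mathbb M(\Gamma)\to\mathbb R$ is a consolidated price of $(\{M_P,\pi_P\}_{P\in\mathcal P},\Gamma)$ if $\psi=\Gamma((\Pi_P))|_{\mathbb M(\Gamma)}$ for some $\Pi_P=E^P[Z_P\,\cdot\,]$ such that, for every $P\in\Gamma(\mathcal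 P)$, $Z_P\in L^2(P)_+$ and $E^P[Z_P\,\cdot\,]=\pi_P$ on $M_P$. **Viability.** $\mathbb A(\mathcal P)$ is the set of complete and transitive relations $\succsim$ on $\mathbb R\times L^2(\mathcal P)$ that are convex (every set $\{b:b\succsim a\}$ is convex), $c_{2,\mathcal P}$-continuous (all sets $\{b:b\succsim a\}$ and $\{b:a\succsim b\}$ are closed) and strictly monotone ($a+(t,X)\succ a$ whenever $t\ge 0$, $X\ge 0$ and $t>0$ or $X$ is strictly positive). The price system with consolidated price $\psi$ is *scenario-based viable* if there are $\succsim\,\in\mathbb A(\mathcal P)$ and $(\hat x,\hat X)$ in the budget set $B=\{(y,Y)\in\mathbb R\times\mathbb M(\Gamma):y+\psi(Y)\le\psi(0)\}$ with $(\hat x,\hat X)\succsim(x,X)$ for all $(x,X)\in B$. **Theorem 1.** Let $\psi:\mathbb M(\Gamma)\to\mathbb R$ be a consolidated price of $(\{M_P,\pi_P\}_{P\in\mathcal P},\Gamma)$. The price system is scenario-based viable if and only if there is $\Psi\in\mathfrak P(\mathcal P)_{++}$ with $\Psi|_{\mathbb M(\Gamma)}=\psi$. -/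

import Mathlib

open MeasureTheory Topology
open scoped ENNReal NNReal BoundedContinuousFunction

set_option linter.unusedSectionVars false

noncomputable section

namespace ScenarioPricing

variable {Ω : Type*} [TopologicalSpace Ω] [MeasurableSpace Ω] [BorelSpace Ω]

/-! ### The capacity norm and the space of contingent claims -/

/-- The capacity norm `c₂(X) = (sup_{P ∈ 𝓟} E^P[X²])^{1/2}` of a function, written as the supremum
over the priors `P ∈ 𝓟` of the `L²(P)`-norms, with values in `[0, ∞]`. -/
def capNorm (𝓟 : Set (ProbabilityMeasure Ω)) (X : Ω → ℝ) : ℝ≥0∞ :=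
  ⨆ P ∈ 𝓟, eLpNorm X 2 (P : Measure Ω)

lemma capNorm_zero (𝓟 : Set (ProbabilityMeasure Ω)) : capNorm 𝓟 (0 : Ω → ℝ) = 0 := by
  simp [capNorm]

lemma capNorm_add_le (𝓟 : Set (ProbabilityMeasure Ω)) {X Y : Ω → ℝ} (hX : Measurable X)
    (hY : Measurable Y) : capNorm 𝓟 (X + Y) ≤ capNorm 𝓟 X + capNorm 𝓟 Y := by
  refine iSup₂_le fun P hP => ?_
  refine (eLpNorm_add_le hX.aestronglyMeasurable hY.aestronglyMeasurable (by norm_num)).trans ?_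
  exact add_le_add (le_iSup₂ (f := fun (P : ProbabilityMeasure Ω) (_ : P ∈ 𝓟) =>
      eLpNorm X 2 (P : Measure Ω)) P hP)
    (le_iSup₂ (f := fun (P : ProbabilityMeasure Ω) (_ : P ∈ 𝓟) =>
      eLpNorm Y 2 (P : Measure Ω)) P hP)

lemma capNorm_smul (𝓟 : Set (ProbabilityMeasure Ω)) (c : ℝ) (X : Ω → ℝ) :
    capNorm 𝓟 (c • X) = ‖c‖ₑ * capNorm 𝓟 X := by
  simp only [capNorm, eLpNorm_const_smul, ENNReal.mul_iSup]

lemma capNorm_neg (𝓟 : Set (ProbabilityMeasure Ω)) (X : Ω → ℝ) :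
    capNorm 𝓟 (-X) = capNorm 𝓟 X := by
  simp [capNorm, eLpNorm_neg]

lemma capNorm_bounded_lt_top (𝓟 : Set (ProbabilityMeasure Ω)) (g : Ω →ᵇ ℝ) :
    capNorm 𝓟 (g : Ω → ℝ) < ∞ := by
  refine lt_of_le_of_lt (b := ENNReal.ofReal ‖g‖) (iSup₂_le fun P _ => ?_) ENNReal.ofReal_lt_top
  refine (eLpNorm_le_of_ae_bound (C := ‖g‖)
    (Filter.Eventually.of_forall fun x => g.norm_coe_le_norm x)).trans ?_
  simp

/-- `𝓛²(𝓟)`: the Borel functions in the closure of the bounded continuous functions with respect to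
the capacity norm. -/
def claims (𝓟 : Set (ProbabilityMeasure Ω)) : Submodule ℝ (Ω → ℝ) where
  carrier := {X | Measurable X ∧
    ∀ ε : ℝ≥0∞, 0 < ε → ∃ g : Ω →ᵇ ℝ, capNorm 𝓟 (X - (g : Ω → ℝ)) ≤ ε}
  zero_mem' := ⟨measurable_zero, fun ε _ => ⟨0, by
    have h : (0 : Ω → ℝ) - ((0 : Ω →ᵇ ℝ) : Ω → ℝ) = 0 := by ext; simp
    rw [h, capNorm_zero]; exact zero_le⟩⟩
  add_mem' := by
    rintro X Y ⟨hX, hX'⟩ ⟨hY, hY'⟩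
    refine ⟨hX.add hY, fun ε hε => ?_⟩
    obtain ⟨g, hg⟩ := hX' (ε / 2) (ENNReal.half_pos hε.ne')
    obtain ⟨h, hh⟩ := hY' (ε / 2) (ENNReal.half_pos hε.ne')
    refine ⟨g + h, ?_⟩
    have e : X + Y - ((g + h : Ω →ᵇ ℝ) : Ω → ℝ) = (X - (g : Ω → ℝ)) + (Y - (h : Ω → ℝ)) := by
      ext; simp; ring
    rw [e]
    refine (capNorm_add_le 𝓟 (hX.sub g.continuous.measurable)
      (hY.sub h.continuous.measurable)).trans ?_
    exact (add_le_add hg hh).trans (ENNReal.add_halves ε).le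
  smul_mem' := by
    rintro c X ⟨hX, hX'⟩
    refine ⟨hX.const_smul c, fun ε hε => ?_⟩
    obtain ⟨g, hg⟩ := hX' (ε / ‖c‖ₑ) (ENNReal.div_pos hε.ne' enorm_ne_top)
    refine ⟨c • g, ?_⟩
    have e : c • X - ((c • g : Ω →ᵇ ℝ) : Ω → ℝ) = c • (X - (g : Ω → ℝ)) := by
      ext; simp; ring
    rw [e, capNorm_smul]
    exact (mul_le_mul_right hg _).trans ENNReal.mul_div_le

lemma capNorm_lt_top {𝓟 : Set (ProbabilityMeasure Ω)} {X : Ω → ℝ} (hX : X ∈ claims 𝓟) :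
    capNorm 𝓟 X < ∞ := by
  obtain ⟨g, hg⟩ := hX.2 1 one_pos
  have e : X = (X - (g : Ω → ℝ)) + (g : Ω → ℝ) := by simp
  rw [e]
  exact (capNorm_add_le 𝓟 (hX.1.sub g.continuous.measurable) g.continuous.measurable).trans_lt
    (ENNReal.add_lt_top.2 ⟨hg.trans_lt ENNReal.one_lt_top, capNorm_bounded_lt_top 𝓟 g⟩)

/-- `𝓛²(𝓟)` as a type of its own (so that it carries the topology of the capacity norm and not
that of pointwise convergence). -/
def ClaimFun (𝓟 : Set (ProbabilityMeasure Ω)) : Type _ := claims 𝓟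

instance (𝓟 : Set (ProbabilityMeasure Ω)) : AddCommGroup (ClaimFun 𝓟) :=
  inferInstanceAs (AddCommGroup (claims 𝓟))

instance (𝓟 : Set (ProbabilityMeasure Ω)) : Module ℝ (ClaimFun 𝓟) :=
  inferInstanceAs (Module ℝ (claims 𝓟))

/-- The underlying function of an element of `𝓛²(𝓟)`, as a linear map. -/
def ClaimFun.toFun (𝓟 : Set (ProbabilityMeasure Ω)) : ClaimFun 𝓟 →ₗ[ℝ] (Ω → ℝ) :=
  (claims 𝓟).subtype

lemma ClaimFun.toFun_mem {𝓟 : Set (ProbabilityMeasure Ω)} (X : ClaimFun 𝓟) :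
    ClaimFun.toFun 𝓟 X ∈ claims 𝓟 := Subtype.property (p := (· ∈ claims 𝓟)) X

/-- The capacity norm, as a seminorm on `𝓛²(𝓟)`. -/
def capSeminorm (𝓟 : Set (ProbabilityMeasure Ω)) : AddGroupSeminorm (ClaimFun 𝓟) where
  toFun X := (capNorm 𝓟 (ClaimFun.toFun 𝓟 X)).toReal
  map_zero' := by rw [map_zero, capNorm_zero]; rfl
  add_le' X Y := by
    rw [map_add, ← ENNReal.toReal_add (capNorm_lt_top X.toFun_mem).ne
      (capNorm_lt_top Y.toFun_mem).ne]
    exact ENNReal.toReal_mono (ENNReal.add_ne_top.2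
      ⟨(capNorm_lt_top X.toFun_mem).ne, (capNorm_lt_top Y.toFun_mem).ne⟩)
      (capNorm_add_le 𝓟 X.toFun_mem.1 Y.toFun_mem.1)
  neg' X := by rw [map_neg, capNorm_neg]

instance (𝓟 : Set (ProbabilityMeasure Ω)) : SeminormedAddCommGroup (ClaimFun 𝓟) :=
  (capSeminorm 𝓟).toSeminormedAddCommGroup

lemma ClaimFun.norm_def {𝓟 : Set (ProbabilityMeasure Ω)} (X : ClaimFun 𝓟) :
    ‖X‖ = (capNorm 𝓟 (ClaimFun.toFun 𝓟 X)).toReal := rfl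

instance (𝓟 : Set (ProbabilityMeasure Ω)) : NormedSpace ℝ (ClaimFun 𝓟) where
  norm_smul_le c X := by
    rw [ClaimFun.norm_def, ClaimFun.norm_def, map_smul, capNorm_smul, ENNReal.toReal_mul]
    simp

/-- `L²(𝓟)`: the quotient of `𝓛²(𝓟)` by the null elements of the capacity norm, a normed space. -/
abbrev L2 (𝓟 : Set (ProbabilityMeasure Ω)) : Type _ := SeparationQuotient (ClaimFun 𝓟)

/-- The quotient map `𝓛²(𝓟) → L²(𝓟)`. -/
def toL2 (𝓟 : Set (ProbabilityMeasure Ω)) : ClaimFun 𝓟 →L[ℝ] L2 𝓟 :=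
  SeparationQuotient.mkCLM ℝ (ClaimFun 𝓟)

/-- A (chosen) representative of an element of `L²(𝓟)`. Two representatives agree quasi-surely,
i.e. `P`-almost surely for all `P ∈ 𝓟`. -/
def rep {𝓟 : Set (ProbabilityMeasure Ω)} (X : L2 𝓟) : Ω → ℝ := ClaimFun.toFun 𝓟 (Quotient.out X)

/-- `X ≥ 0` quasi-surely. -/
def IsNonneg {𝓟 : Set (ProbabilityMeasure Ω)} (X : L2 𝓟) : Prop :=
  ∀ P ∈ 𝓟, ∀ᵐ ω ∂(P : Measure Ω), 0 ≤ rep X ω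

/-- `X ≥ 0` quasi-surely, and `P(X > 0) > 0` for some prior `P ∈ 𝓟`. -/
def IsStrictlyPos {𝓟 : Set (ProbabilityMeasure Ω)} (X : L2 𝓟) : Prop :=
  IsNonneg X ∧ ∃ P ∈ 𝓟, 0 < (P : Measure Ω) {ω | 0 < rep X ω}

/-! ### The price space -/

/-- `k(𝓟)`: the closed convex hull of `𝓟` for the weak topology (formed in the finite measures). -/
def closedHull (𝓟 : Set (ProbabilityMeasure Ω)) : Set (ProbabilityMeasure Ω) :=
  {Q | Q.toFiniteMeasure ∈ closure (convexHull ℝ≥0 (ProbabilityMeasure.toFiniteMeasure '' 𝓟))}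

/-- `Z ∈ L²(P)₊`. -/
def IsDensity (P : ProbabilityMeasure Ω) (Z : Ω → ℝ) : Prop :=
  MemLp Z 2 (P : Measure Ω) ∧ 0 ≤ᵐ[(P : Measure Ω)] Z

/-- The linear price functional `X ↦ E^P[Z X]` on `L²(𝓟)`. -/
def linearPrice {𝓟 : Set (ProbabilityMeasure Ω)} (P : ProbabilityMeasure Ω) (Z : Ω → ℝ)
    (X : L2 𝓟) : ℝ :=
  ∫ ω, Z ω * rep X ω ∂(P : Measure Ω)

/-- The coherent price space `𝔓(𝓟)`: the real-valued functionals
`Ψ(X) = sup_{P ∈ A} E^P[Z_P X]` on `L²(𝓟)`, for a nonempty `A ⊆ k(𝓟)` and `Z_P ∈ L²(P)₊`. -/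
def priceSpace (𝓟 : Set (ProbabilityMeasure Ω)) : Set (L2 𝓟 → ℝ) :=
  {Ψ | ∃ (A : Set (ProbabilityMeasure Ω)) (Z : ProbabilityMeasure Ω → Ω → ℝ),
    A.Nonempty ∧ A ⊆ closedHull 𝓟 ∧ (∀ P ∈ A, IsDensity P (Z P)) ∧
    ∀ X : L2 𝓟, IsLUB ((fun P => linearPrice P (Z P) X) '' A) (Ψ X)}

/-- `𝔓(𝓟)₊₊`: the strictly positive elements of the coherent price space. -/
def strictlyPositivePrices (𝓟 : Set (ProbabilityMeasure Ω)) : Set (L2 𝓟 → ℝ) :=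
  {Ψ | Ψ ∈ priceSpace 𝓟 ∧ ∀ X : L2 𝓟, IsStrictlyPos X → 0 < Ψ X}

/-! ### Scenario-based markets, consolidation, and the marketed space -/

/-- The scenario-based marketed spaces and prices `(M_P, π_P)_{P ∈ 𝓟}`: for each prior a closed
subspace `M_P` of `L²(P)` and a linear functional `π_P` on it. To form the linear hull of marketed
spaces that belong to different priors, the elements of `M_P` have to be read as random variables:
`version P` is a linear space of Borel functions whose `P`-classes are exactly the elements of
`M_P` (for instance, but not necessarily, all Borel functions with `P`-class in `M_P`). -/
structure Market (𝓟 : Set (ProbabilityMeasure Ω)) where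
  /-- The marketed space `M_P`. -/
  M : (P : 𝓟) → Submodule ℝ (Lp ℝ 2 (P.1 : Measure Ω))
  isClosed_M : ∀ P, IsClosed (M P : Set (Lp ℝ 2 (P.1 : Measure Ω)))
  /-- The price functional `π_P`. -/
  π : (P : 𝓟) → M P →ₗ[ℝ] ℝ
  /-- The random variables that represent the elements of `M_P`. -/
  version : 𝓟 → Submodule ℝ (Ω → ℝ)
  version_measurable : ∀ P, ∀ X ∈ version P, Measurable X
  version_mem : ∀ P, ∀ X ∈ version P, ∃ x ∈ M P, X =ᵐ[(P.1 : Measure Ω)] x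
  version_exists : ∀ P, ∀ x ∈ M P, ∃ X ∈ version P, X =ᵐ[(P.1 : Measure Ω)] x

/-- A consolidation `Γ`: a pointwise supremum of weightings (convex combinations) of scenarios, each
weighting being a probability measure on `𝓟`. Dirac measures select a single scenario. -/
structure Consolidation (𝓟 : Set (ProbabilityMeasure Ω)) where
  /-- The weightings over which the supremum is taken. -/
  weights : Set (ProbabilityMeasure 𝓟)
  nonempty : weights.Nonempty

/-- `Γ(𝓟)`: the relevant priors, those in the support of some weighting of `Γ`. -/
def Consolidation.relevant {𝓟 : Set (ProbabilityMeasure Ω)} (Γ : Consolidation 𝓟) : Set 𝓟 :=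
  {P | ∃ μ ∈ Γ.weights, P ∈ (μ : Measure 𝓟).support}

/-- `Ψ = Γ(Π)`: the functional `Ψ(X) = sup_{μ ∈ Γ} ∫ Π_P(X) dμ(P)` is well defined and real-valued
on `L²(𝓟)`. -/
def Consolidation.Maps {𝓟 : Set (ProbabilityMeasure Ω)} (Γ : Consolidation 𝓟)
    (Pi : 𝓟 → L2 𝓟 → ℝ) (Ψ : L2 𝓟 → ℝ) : Prop :=
  ∀ X : L2 𝓟, (∀ μ ∈ Γ.weights, Integrable (fun P => Pi P X) (μ : Measure 𝓟)) ∧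
    IsLUB ((fun μ : ProbabilityMeasure 𝓟 => ∫ P, Pi P X ∂(μ : Measure 𝓟)) '' Γ.weights) (Ψ X)

/-- The `Γ`-marketed space `𝕄(Γ)`: the capacity-norm closure of the claims in `L²(𝓟)` that lie in
the linear hull of the marketed spaces `M_P` of the relevant priors `P ∈ Γ(𝓟)`. -/
def marketedSpace {𝓟 : Set (ProbabilityMeasure Ω)} (E : Market 𝓟) (Γ : Consolidation 𝓟) :
    Submodule ℝ (L2 𝓟) :=
  (((⨆ P ∈ Γ.relevant, E.version P).comap (ClaimFun.toFun 𝓟)).map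
    (toL2 𝓟).toLinearMap).topologicalClosure

/-- `Γ` maps the scenario-based prices `(π_P)` to the consolidated price `ψ` on `𝕄(Γ)`: the
consolidation acts on families of positive continuous linear functionals `Π_P = E^P[Z_P ·]`,
`Z_P ∈ L²(P)₊`, and `ψ` is the restriction to `𝕄(Γ)` of `Γ((Π_P))`, where `Π_P` extends `π_P` for
each relevant prior `P`. -/
def IsConsolidatedPrice {𝓟 : Set (ProbabilityMeasure Ω)} (E : Market 𝓟) (Γ : Consolidation 𝓟)
    (ψ : marketedSpace E Γ → ℝ) : Prop :=
  ∃ (Z : 𝓟 → Ω → ℝ) (Ψ : L2 𝓟 → ℝ),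
    (∀ P ∈ Γ.relevant, IsDensity P.1 (Z P) ∧
      ∀ x : E.M P, E.π P x = ∫ ω, Z P ω * (x : Lp ℝ 2 (P.1 : Measure Ω)) ω ∂(P.1 : Measure Ω)) ∧
    Γ.Maps (fun P X => linearPrice P.1 (Z P) X) Ψ ∧
    ∀ Y : marketedSpace E Γ, ψ Y = Ψ (Y : L2 𝓟)

/-! ### Preferences and viability -/

/-- The class `𝔸(𝓟)` of preference relations on `ℝ × L²(𝓟)` (`pref a b` means that `a` is weakly
preferred to `b`): rational, convex, continuous for the capacity norm, and strictly monotone. -/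
structure IsPreference (𝓟 : Set (ProbabilityMeasure Ω))
    (pref : ℝ × L2 𝓟 → ℝ × L2 𝓟 → Prop) : Prop where
  complete : ∀ a b, pref a b ∨ pref b a
  transitive : ∀ a b c, pref a b → pref b c → pref a c
  convex : ∀ a, Convex ℝ {b | pref b a}
  closed_upper : ∀ a, IsClosed {b | pref b a}
  closed_lower : ∀ a, IsClosed {b | pref a b}
  strictMono : ∀ (a : ℝ × L2 𝓟) (t : ℝ) (X : L2 𝓟), 0 ≤ t → IsNonneg X →
    (0 < t ∨ IsStrictlyPos X) → pref (a + (t, X)) a ∧ ¬ pref a (a + (t, X))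

/-- The budget set `B(x, X, ψ, 𝕄) = {(y, Y) ∈ ℝ × 𝕄 : y + ψ(Y) ≤ x + ψ(X)}`. -/
def budgetSet {𝓟 : Set (ProbabilityMeasure Ω)} {𝕄 : Submodule ℝ (L2 𝓟)} (x : ℝ) (X : 𝕄)
    (ψ : 𝕄 → ℝ) : Set (ℝ × 𝕄) :=
  {b | b.1 + ψ b.2 ≤ x + ψ X}

/-- Scenario-based viability of a price functional `ψ` on a marketed space `𝕄`. -/
def IsViable {𝓟 : Set (ProbabilityMeasure Ω)} {𝕄 : Submodule ℝ (L2 𝓟)} (ψ : 𝕄 → ℝ) : Prop :=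
  ∃ pref : ℝ × L2 𝓟 → ℝ × L2 𝓟 → Prop, IsPreference 𝓟 pref ∧
    ∃ a ∈ budgetSet 0 0 ψ, ∀ b ∈ budgetSet 0 0 ψ, pref (a.1, (a.2 : L2 𝓟)) (b.1, (b.2 : L2 𝓟))

end ScenarioPricing

end

noncomputable section

namespace ScenarioPricing

open Filter (Tendsto atTop)

/-! ### Barycenters of a compact family of priors -/

section Barycenter

variable {Ω : Type*} [TopologicalSpace Ω] [PolishSpace Ω] [MeasurableSpace Ω] [BorelSpace Ω]
variable {K : Type*} [TopologicalSpace K] [MeasurableSpace K] [BorelSpace K]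

/-! Each weighting `μ` integrates the scenario prices to a positive linear functional on `L2 𝓟`,
which is automatically continuous (`continuous_of_nonneg`). Hence `ψ` is the restriction of a
sublinear `Ψ₀`, the supremum of a set `D` of positive functionals. Both directions pass through one
criterion: viability amounts to a continuous, strictly positive linear `φ` with `φ ≤ ψ` on the
marketed space. Given `φ`, the utility `x + φ X` makes the zero bundle optimal. Conversely, `φ`
comes from a hyperplane separating the bundles strictly preferred to the optimum from the budget
cone (`exists_functional_of_isViable`).

From `Ψ` to `φ`: `L2 𝓟` is separable, so the supremum defining `Ψ` can be taken over a sequence of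
positive functionals. Their geometric mixture lies below `Ψ` and is positive wherever one of them is
(`exists_strictlyPositive_le`).

From `φ` to `Ψ`: take `φ ⊔ Ψ₀`, which restricts to `ψ`. The difficulty is its membership in the
price space, which allows a single density for each prior of the closed convex hull. A separation
argument with compactness of the hull dominates each positive functional by the `L²(Q)`-norm of one
`Q` in the hull, and Riesz then yields a density. Mixing `Q` with another prior gives infinitely
many representing priors. After reduction to countably many functionals, Hall's theorem assigns them
distinct priors (`mem_priceSpace_of_isLUB`). With a single prior no mixing is available, but then
`ψ` is linear, and `φ ≤ ψ` forces equality. -/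

/-- Closed sets form a generating π-system, and the mass of a closed set is a sequential limit of
integrals of bounded continuous functions, each continuous in `x`. -/
lemma measurable_of_continuous_probabilityMeasure {p : K → ProbabilityMeasure Ω}
    (hp : Continuous p) : Measurable fun x => (p x : Measure Ω) := by
  refine Measurable.measure_of_isPiSystem_of_isProbabilityMeasure (S := {s | IsClosed s})
    ((BorelSpace.measurable_eq (α := Ω)).trans borel_eq_generateFrom_isClosed)
    isPiSystem_isClosed fun F hF => ?_
  have hF' : IsClosed F := hF
  refine ENNReal.measurable_of_tendsto
    (f := fun n x => ∫⁻ ω, (hF'.apprSeq n ω : ℝ≥0∞) ∂(p x : Measure Ω)) (fun n => ?_) ?_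
  · exact ((ProbabilityMeasure.continuous_lintegral_boundedContinuousFunction
      (hF'.apprSeq n)).comp hp).measurable
  · rw [tendsto_pi_nhds]
    intro x
    exact HasOuterApproxClosed.tendsto_lintegral_apprSeq hF' (p x : Measure Ω)

/-- The barycenter `∫ p(x) dμ(x)` of a finite measure `μ` on a continuous family of priors. -/
def barycenter (p : K → ProbabilityMeasure Ω) (hp : Continuous p) :
    FiniteMeasure K →ₗ[ℝ≥0] FiniteMeasure Ω where
  toFun μ := ⟨(μ : Measure K).bind fun x => (p x : Measure Ω), ⟨by
    rw [Measure.bind_apply MeasurableSet.univ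
      (measurable_of_continuous_probabilityMeasure hp).aemeasurable]
    simp⟩⟩
  map_add' μ ν := by
    apply Subtype.ext
    ext s hs
    have hm := measurable_of_continuous_probabilityMeasure hp
    change ((μ : Measure K) + (ν : Measure K)).bind _ s =
      (μ : Measure K).bind _ s + (ν : Measure K).bind _ s
    simp [Measure.bind_apply hs hm.aemeasurable]
  map_smul' c μ := by
    apply Subtype.ext
    ext s hs
    have hm := measurable_of_continuous_probabilityMeasure hp
    change (c • (μ : Measure K)).bind _ s = c • (μ : Measure K).bind _ s
    simp [Measure.bind_apply hs hm.aemeasurable]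

lemma lintegral_barycenter {p : K → ProbabilityMeasure Ω} (hp : Continuous p)
    (μ : FiniteMeasure K) {h : Ω → ℝ≥0∞} (hh : Measurable h) :
    ∫⁻ ω, h ω ∂(barycenter p hp μ : Measure Ω) = ∫⁻ x, ∫⁻ ω, h ω ∂(p x : Measure Ω) ∂μ :=
  Measure.lintegral_bind (measurable_of_continuous_probabilityMeasure hp).aemeasurable
    hh.aemeasurable

/-- Testing the barycenter against `f` is testing `μ` against `x ↦ ∫ f d(p x)`, which is continuous,
and bounded because `K` is compact. -/
lemma continuous_barycenter [CompactSpace K] {p : K → ProbabilityMeasure Ω} (hp : Continuous p) :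
    Continuous (barycenter p hp) := by
  rw [FiniteMeasure.continuous_iff_forall_continuous_lintegral]
  intro f
  have hc : Continuous fun x => (p x).toFiniteMeasure.testAgainstNN f :=
    (FiniteMeasure.continuous_testAgainstNN_eval f).comp
      (ProbabilityMeasure.toFiniteMeasure_continuous.comp hp)
  let F : K →ᵇ ℝ≥0 := BoundedContinuousFunction.mkOfCompact ⟨_, hc⟩
  have e : ∀ μ : FiniteMeasure K, ∫⁻ ω, f ω ∂(barycenter p hp μ : Measure Ω) = ∫⁻ x, F x ∂μ := by
    intro μ
    rw [lintegral_barycenter hp μ (by fun_prop)]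
    refine lintegral_congr fun x => ?_
    exact (FiniteMeasure.testAgainstNN_coe_eq (μ := (p x).toFiniteMeasure) (f := f)).symm
  simp_rw [e]
  exact FiniteMeasure.continuous_lintegral_boundedContinuousFunction F

lemma convex_finiteMeasure_mass_eq_one : Convex ℝ≥0 {μ : FiniteMeasure K | μ.mass = 1} := by
  intro μ hμ ν hν a b _ _ hab
  simp only [Set.mem_ofPred_eq] at hμ hν ⊢
  have : (a • μ + b • ν).mass = a * μ.mass + b * ν.mass := by
    simp only [FiniteMeasure.mass, FiniteMeasure.coeFn_add, FiniteMeasure.coeFn_smul,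
      Pi.add_apply, Pi.smul_apply, smul_eq_mul]
  rw [this, hμ, hν, mul_one, mul_one, hab]

end Barycenter

/-! ### The weakly closed convex hull of the priors -/

section ClosedHull

variable {Ω : Type*} [TopologicalSpace Ω] [PolishSpace Ω] [MeasurableSpace Ω] [BorelSpace Ω]

/-- Integrals of Borel functions do not pass to weak limits, but they do pass to barycenters. The
barycenters of probability measures on `K` form a compact convex set containing every `p x` (by
Dirac masses), hence the whole closed hull. -/
lemma exists_compact_barycenters {K : Type*} [TopologicalSpace K] [CompactSpace K] [T2Space K]
    {p : K → ProbabilityMeasure Ω} (hp : Continuous p) :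
    ∃ S : Set (FiniteMeasure Ω), IsCompact S ∧ closure (convexHull ℝ≥0
        (Set.range fun x => (p x).toFiniteMeasure)) ⊆ S ∧
      ∀ ν ∈ S, ∀ h : Ω → ℝ≥0∞, Measurable h →
        ∫⁻ ω, h ω ∂(ν : Measure Ω) ≤ ⨆ x, ∫⁻ ω, h ω ∂(p x : Measure Ω) := by
  let : MeasurableSpace K := borel K
  have : BorelSpace K := ⟨rfl⟩
  have hS : IsCompact (barycenter p hp '' {μ : FiniteMeasure K | μ.mass = 1}) :=
    (isCompact_setOfPred_finiteMeasure_eq_of_compactSpace K 1).image (continuous_barycenter hp)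
  refine ⟨_, hS, ?_, ?_⟩
  · refine hS.isClosed.closure_subset_iff.2 (convexHull_min ?_ ?_)
    · rintro _ ⟨x, rfl⟩
      refine ⟨⟨Measure.dirac x, inferInstance⟩, ?_, ?_⟩
      · have : (Measure.dirac x : Measure K) Set.univ = 1 := by simp
        exact congrArg ENNReal.toNNReal this
      · apply Subtype.ext
        exact Measure.dirac_bind (measurable_of_continuous_probabilityMeasure hp) x
    · exact convex_finiteMeasure_mass_eq_one.linear_image (barycenter p hp)
  · rintro _ ⟨μ, hμ, rfl⟩ h hh
    rw [lintegral_barycenter hp μ hh]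
    refine (lintegral_mono fun x => le_iSup (fun x => ∫⁻ ω, h ω ∂(p x : Measure Ω)) x).trans ?_
    have hμ' : (μ : Measure K) Set.univ = 1 := by
      rw [← FiniteMeasure.ennreal_mass, hμ]; rfl
    rw [lintegral_const, hμ', mul_one]

variable {𝓟 : Set (ProbabilityMeasure Ω)}

lemma exists_compact_closedHull (hP : IsCompact 𝓟) :
    ∃ S : Set (FiniteMeasure Ω), IsCompact S ∧
      closure (convexHull ℝ≥0 (ProbabilityMeasure.toFiniteMeasure '' 𝓟)) ⊆ S ∧
      ∀ ν ∈ S, ∀ h : Ω → ℝ≥0∞, Measurable h →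
        ∫⁻ ω, h ω ∂(ν : Measure Ω) ≤ ⨆ P ∈ 𝓟, ∫⁻ ω, h ω ∂(P : Measure Ω) := by
  have : CompactSpace 𝓟 := isCompact_iff_compactSpace.1 hP
  obtain ⟨S, h1, h2, h3⟩ := exists_compact_barycenters (K := 𝓟) (p := Subtype.val)
    continuous_subtype_val
  refine ⟨S, h1, ?_, fun ν hν h hh => (h3 ν hν h hh).trans (by rw [iSup_subtype])⟩
  rwa [Set.image_eq_range]

/-- The upper expectation of a Borel function does not increase when passing from the priors to
their closed convex hull. -/
lemma lintegral_le_of_mem_closedHull (hP : IsCompact 𝓟) {Q : ProbabilityMeasure Ω}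
    (hQ : Q ∈ closedHull 𝓟) {h : Ω → ℝ≥0∞} (hh : Measurable h) :
    ∫⁻ ω, h ω ∂(Q : Measure Ω) ≤ ⨆ P ∈ 𝓟, ∫⁻ ω, h ω ∂(P : Measure Ω) := by
  obtain ⟨S, -, h2, h3⟩ := exists_compact_closedHull hP
  exact h3 _ (h2 hQ) h hh

/-- The closure is taken in the finite measures, where it is compact; having mass one is a closed
condition, and the probability measures embed topologically. -/
lemma isCompact_closedHull (hP : IsCompact 𝓟) : IsCompact (closedHull 𝓟) := by
  obtain ⟨S, h1, h2, -⟩ := exists_compact_closedHull hP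
  have hc := h1.of_isClosed_subset isClosed_closure h2
  rw [(ProbabilityMeasure.toFiniteMeasure_isEmbedding Ω).isCompact_iff]
  refine hc.of_isClosed_subset ?_ ?_
  · have : ProbabilityMeasure.toFiniteMeasure '' closedHull 𝓟 =
        closure (convexHull ℝ≥0 (ProbabilityMeasure.toFiniteMeasure '' 𝓟)) ∩
          {μ : FiniteMeasure Ω | μ.mass = 1} := by
      rw [← ProbabilityMeasure.range_toFiniteMeasure]
      exact Set.image_preimage_eq_inter_range
    rw [this]
    exact isClosed_closure.inter (isClosed_eq (by fun_prop) continuous_const)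
  · rintro _ ⟨Q, hQ, rfl⟩
    exact hQ

lemma subset_closedHull : 𝓟 ⊆ closedHull 𝓟 := fun P hP =>
  subset_closure (subset_convexHull _ _ ⟨P, hP, rfl⟩)

/-- The closed hull is stable under convex combinations. -/
lemma exists_mem_closedHull_convexCombination {Q R : ProbabilityMeasure Ω}
    (hQ : Q ∈ closedHull 𝓟) (hR : R ∈ closedHull 𝓟) {a b : ℝ≥0} (hab : a + b = 1) :
    ∃ S ∈ closedHull 𝓟, (S : Measure Ω) = a • (Q : Measure Ω) + b • (R : Measure Ω) := by
  have hp : IsProbabilityMeasure (a • (Q : Measure Ω) + b • (R : Measure Ω)) := ⟨by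
    rw [Measure.add_apply, Measure.smul_apply, Measure.smul_apply, measure_univ, measure_univ,
      ENNReal.smul_def, ENNReal.smul_def, smul_eq_mul, smul_eq_mul, mul_one, mul_one,
      ← ENNReal.coe_add, hab, ENNReal.coe_one]⟩
  refine ⟨⟨_, hp⟩, ?_, rfl⟩
  exact map_mem_closure₂ (f := fun μ ν : FiniteMeasure Ω => a • μ + b • ν) (by fun_prop) hQ hR
    fun μ hμ ν hν => (convex_convexHull ℝ≥0 _) hμ hν (zero_le) (zero_le) hab

end ClosedHull

/-! ### Claims as square integrable random variables under the priors of the hull -/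

section Claims

variable {Ω : Type*} [TopologicalSpace Ω] [MeasurableSpace Ω] [BorelSpace Ω]
variable {𝓟 : Set (ProbabilityMeasure Ω)}

lemma toL2_out (X : L2 𝓟) : toL2 𝓟 (Quotient.out X) = X := Quotient.out_eq X

lemma toL2_surjective : Function.Surjective (toL2 𝓟) := fun X => ⟨_, toL2_out X⟩

lemma norm_toL2 (x : ClaimFun 𝓟) : ‖toL2 𝓟 x‖ = ‖x‖ := SeparationQuotient.norm_mk x

lemma norm_eq_capNorm_rep (X : L2 𝓟) : ‖X‖ = (capNorm 𝓟 (rep X)).toReal := by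
  conv_lhs => rw [← toL2_out X]
  rw [norm_toL2, ClaimFun.norm_def, rep]

lemma rep_mem (X : L2 𝓟) : rep X ∈ claims 𝓟 := ClaimFun.toFun_mem _

lemma measurable_rep (X : L2 𝓟) : Measurable (rep X) := (rep_mem X).1

lemma ofReal_norm_claimFun (x : ClaimFun 𝓟) :
    ENNReal.ofReal ‖x‖ = capNorm 𝓟 (ClaimFun.toFun 𝓟 x) := by
  rw [ClaimFun.norm_def, ENNReal.ofReal_toReal (capNorm_lt_top x.toFun_mem).ne]

/-- The element of `𝓛²(𝓟)` given by a function. -/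
def ClaimFun.mk (X : Ω → ℝ) (hX : X ∈ claims 𝓟) : ClaimFun 𝓟 := (⟨X, hX⟩ : claims 𝓟)

lemma ClaimFun.toFun_mk (X : Ω → ℝ) (hX : X ∈ claims 𝓟) :
    ClaimFun.toFun 𝓟 (ClaimFun.mk X hX) = X := rfl

lemma boundedContinuous_mem_claims (f : Ω →ᵇ ℝ) : (f : Ω → ℝ) ∈ claims 𝓟 :=
  ⟨f.continuous.measurable, fun ε _ => ⟨f, by rw [sub_self, capNorm_zero]; exact zero_le⟩⟩

variable (𝓟) in
/-- Bounded continuous functions as elements of `L²(𝓟)`. -/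
def ofBoundedContinuous : (Ω →ᵇ ℝ) →ₗ[ℝ] L2 𝓟 :=
  (toL2 𝓟).toLinearMap ∘ₗ
    { toFun := fun f => ClaimFun.mk f (boundedContinuous_mem_claims f)
      map_add' := fun _ _ => rfl
      map_smul' := fun _ _ => rfl }

lemma ofBoundedContinuous_eq (f : Ω →ᵇ ℝ) :
    ofBoundedContinuous 𝓟 f = toL2 𝓟 (ClaimFun.mk f (boundedContinuous_mem_claims f)) := rfl

lemma denseRange_ofBoundedContinuous : DenseRange (ofBoundedContinuous 𝓟) := by
  intro X
  obtain ⟨x, rfl⟩ := toL2_surjective X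
  rw [Metric.mem_closure_iff]
  intro ε hε
  obtain ⟨g, hg⟩ := x.toFun_mem.2 (ENNReal.ofReal (ε / 2)) (by positivity)
  refine ⟨_, ⟨g, rfl⟩, ?_⟩
  rw [dist_eq_norm, ofBoundedContinuous_eq, ← map_sub, norm_toL2, ClaimFun.norm_def]
  calc _ ≤ ε / 2 := ENNReal.toReal_le_of_le_ofReal (by positivity) hg
    _ < ε := half_lt_self hε

lemma abs_mem_claims {X : Ω → ℝ} (hX : X ∈ claims 𝓟) : (fun ω => |X ω|) ∈ claims 𝓟 := by
  refine ⟨hX.1.abs, fun ε hε => ?_⟩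
  obtain ⟨g, hg⟩ := hX.2 ε hε
  refine ⟨|g|, (iSup₂_mono fun P _ => eLpNorm_mono fun ω => ?_).trans hg⟩
  simpa using abs_abs_sub_abs_le_abs_sub (X ω) (g ω)

lemma capNorm_abs (X : Ω → ℝ) : capNorm 𝓟 (fun ω => |X ω|) = capNorm 𝓟 X := by
  have h : (fun ω => |X ω|) = fun ω => ‖X ω‖ := rfl
  simp only [capNorm, h, eLpNorm_norm]

end Claims

section Embedding

variable {Ω : Type*} [TopologicalSpace Ω] [PolishSpace Ω] [MeasurableSpace Ω] [BorelSpace Ω]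
variable {𝓟 : Set (ProbabilityMeasure Ω)}

lemma eLpNorm_le_capNorm (hP : IsCompact 𝓟) {Q : ProbabilityMeasure Ω} (hQ : Q ∈ closedHull 𝓟)
    {X : Ω → ℝ} (hX : Measurable X) : eLpNorm X 2 (Q : Measure Ω) ≤ capNorm 𝓟 X := by
  have e : ∀ P : ProbabilityMeasure Ω, eLpNorm X 2 (P : Measure Ω) =
      (∫⁻ ω, ‖X ω‖ₑ ^ (2 : ℝ) ∂(P : Measure Ω)) ^ (1 / 2 : ℝ) := fun P => by
    rw [eLpNorm_eq_lintegral_rpow_enorm_toReal (by norm_num) (by norm_num)]; simp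
  have h := lintegral_le_of_mem_closedHull hP hQ (h := fun ω => ‖X ω‖ₑ ^ (2 : ℝ)) (by fun_prop)
  rw [e, one_div, ENNReal.rpow_inv_le_iff (by norm_num)]
  refine h.trans (iSup₂_le fun P hP => ?_)
  rw [← ENNReal.rpow_inv_le_iff (by norm_num), ← one_div, ← e]
  exact le_iSup₂ (f := fun (P : ProbabilityMeasure Ω) (_ : P ∈ 𝓟) =>
      eLpNorm X 2 (P : Measure Ω)) P hP

/-- The upper-expectation bound applied to the indicator of the exceptional set. -/
lemma ae_of_forall_ae (hP : IsCompact 𝓟) {Q : ProbabilityMeasure Ω} (hQ : Q ∈ closedHull 𝓟)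
    {p : Ω → Prop} (hp : MeasurableSet {ω | p ω})
    (h : ∀ P ∈ 𝓟, ∀ᵐ ω ∂(P : Measure Ω), p ω) : ∀ᵐ ω ∂(Q : Measure Ω), p ω := by
  have h1 := lintegral_le_of_mem_closedHull hP hQ
    (h := {ω | p ω}ᶜ.indicator 1) (measurable_one.indicator hp.compl)
  rw [ae_iff]
  simp only [lintegral_indicator_one hp.compl] at h1
  refine le_antisymm (h1.trans (iSup₂_le fun P hP => ?_)) zero_le
  exact (ae_iff.1 (h P hP)).le

lemma memLp_of_mem_claims (hP : IsCompact 𝓟) {Q : ProbabilityMeasure Ω} (hQ : Q ∈ closedHull 𝓟)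
    {X : Ω → ℝ} (hX : X ∈ claims 𝓟) : MemLp X 2 (Q : Measure Ω) :=
  ⟨hX.1.aestronglyMeasurable, (eLpNorm_le_capNorm hP hQ hX.1).trans_lt (capNorm_lt_top hX)⟩

lemma rep_toL2_ae (hP : IsCompact 𝓟) {Q : ProbabilityMeasure Ω} (hQ : Q ∈ closedHull 𝓟)
    (x : ClaimFun 𝓟) : rep (toL2 𝓟 x) =ᵐ[(Q : Measure Ω)] ClaimFun.toFun 𝓟 x := by
  have h0 : toL2 𝓟 (Quotient.out (toL2 𝓟 x) - x) = 0 := by rw [map_sub, toL2_out, sub_self]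
  have h1 : capNorm 𝓟 (ClaimFun.toFun 𝓟 (Quotient.out (toL2 𝓟 x) - x)) = 0 := by
    rw [← ofReal_norm_claimFun, ← norm_toL2, h0, norm_zero, ENNReal.ofReal_zero]
  have h2 := eLpNorm_le_capNorm hP hQ (ClaimFun.toFun_mem (Quotient.out (toL2 𝓟 x) - x)).1
  rw [h1, nonpos_iff_eq_zero, eLpNorm_eq_zero_iff
    (ClaimFun.toFun_mem _).1.aestronglyMeasurable (by norm_num)] at h2
  filter_upwards [h2] with ω hω
  rw [map_sub] at hω
  exact sub_eq_zero.1 hω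

lemma isNonneg_toL2 (hP : IsCompact 𝓟) (x : ClaimFun 𝓟) :
    IsNonneg (toL2 𝓟 x) ↔ ∀ P ∈ 𝓟, ∀ᵐ ω ∂(P : Measure Ω), 0 ≤ ClaimFun.toFun 𝓟 x ω := by
  refine forall₂_congr fun P hPm => ?_
  have h := rep_toL2_ae hP (subset_closedHull hPm) x
  constructor <;> intro h' <;> filter_upwards [h, h'] with ω h1 h2
  · rwa [← h1]
  · rwa [h1]

lemma isNonneg_ae (hP : IsCompact 𝓟) {X : L2 𝓟} (hX : IsNonneg X) {Q : ProbabilityMeasure Ω}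
    (hQ : Q ∈ closedHull 𝓟) : ∀ᵐ ω ∂(Q : Measure Ω), 0 ≤ rep X ω :=
  ae_of_forall_ae hP hQ (measurableSet_le measurable_const (measurable_rep X)) hX

/-- The canonical contraction of `L²(𝓟)` into `L²(Q)` for a prior `Q` of the closed hull. -/
def toLpHull (hP : IsCompact 𝓟) {Q : ProbabilityMeasure Ω} (hQ : Q ∈ closedHull 𝓟) :
    L2 𝓟 →L[ℝ] Lp ℝ 2 (Q : Measure Ω) :=
  LinearMap.mkContinuous
    { toFun := fun X => (memLp_of_mem_claims hP hQ (rep_mem X)).toLp (rep X)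
      map_add' := fun X Y => by
        rw [← MemLp.toLp_add, MemLp.toLp_eq_toLp_iff]
        obtain ⟨x, rfl⟩ := toL2_surjective X
        obtain ⟨y, rfl⟩ := toL2_surjective Y
        rw [← map_add]
        filter_upwards [rep_toL2_ae hP hQ x, rep_toL2_ae hP hQ y, rep_toL2_ae hP hQ (x + y)]
          with ω h1 h2 h3
        rw [h3, map_add, Pi.add_apply, Pi.add_apply, h1, h2]
      map_smul' := fun c X => by
        rw [RingHom.id_apply, ← MemLp.toLp_const_smul, MemLp.toLp_eq_toLp_iff]
        obtain ⟨x, rfl⟩ := toL2_surjective X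
        rw [← map_smul]
        filter_upwards [rep_toL2_ae hP hQ x, rep_toL2_ae hP hQ (c • x)] with ω h1 h3
        rw [h3, map_smul, Pi.smul_apply, Pi.smul_apply, h1] } 1 (fun X => by
      rw [one_mul, LinearMap.coe_mk, AddHom.coe_mk, Lp.norm_toLp, norm_eq_capNorm_rep]
      exact ENNReal.toReal_mono (capNorm_lt_top (rep_mem X)).ne
        (eLpNorm_le_capNorm hP hQ (measurable_rep X)))

lemma toLpHull_ae (hP : IsCompact 𝓟) {Q : ProbabilityMeasure Ω} (hQ : Q ∈ closedHull 𝓟)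
    (X : L2 𝓟) : toLpHull hP hQ X =ᵐ[(Q : Measure Ω)] rep X :=
  MemLp.coeFn_toLp (memLp_of_mem_claims hP hQ (rep_mem X))

/-- The linear price functional `E^Q[Z ·]` as a continuous linear functional. -/
def linearPriceCLM (hP : IsCompact 𝓟) {Q : ProbabilityMeasure Ω} (hQ : Q ∈ closedHull 𝓟)
    {Z : Ω → ℝ} (hZ : IsDensity Q Z) : L2 𝓟 →L[ℝ] ℝ :=
  (innerSL ℝ (hZ.1.toLp Z)).comp (toLpHull hP hQ)

lemma linearPriceCLM_apply (hP : IsCompact 𝓟) {Q : ProbabilityMeasure Ω}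
    (hQ : Q ∈ closedHull 𝓟) {Z : Ω → ℝ} (hZ : IsDensity Q Z) (X : L2 𝓟) :
    linearPriceCLM hP hQ hZ X = linearPrice Q Z X := by
  rw [linearPriceCLM, ContinuousLinearMap.comp_apply, innerSL_apply_apply, L2.inner_def,
    linearPrice]
  refine integral_congr_ae ?_
  filter_upwards [toLpHull_ae hP hQ X, hZ.1.coeFn_toLp] with ω h1 h2
  rw [h1, h2]
  simp [mul_comm]

lemma linearPrice_nonneg (hP : IsCompact 𝓟) {Q : ProbabilityMeasure Ω}
    (hQ : Q ∈ closedHull 𝓟) {Z : Ω → ℝ} (hZ : IsDensity Q Z) {X : L2 𝓟} (hX : IsNonneg X) :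
    0 ≤ linearPrice Q Z X := by
  refine integral_nonneg_of_ae ?_
  filter_upwards [isNonneg_ae hP hX hQ, hZ.2] with ω h1 h2
  exact mul_nonneg h2 h1

end Embedding

/-! ### Positive linear functionals are continuous -/

section AutomaticContinuity

variable {Ω : Type*} [TopologicalSpace Ω] [MeasurableSpace Ω] [BorelSpace Ω]
variable {𝓟 : Set (ProbabilityMeasure Ω)}

lemma eLpNorm_le_capNorm_of_mem {P : ProbabilityMeasure Ω} (hP : P ∈ 𝓟) (X : Ω → ℝ) :
    eLpNorm X 2 (P : Measure Ω) ≤ capNorm 𝓟 X :=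
  le_iSup₂ (f := fun (P : ProbabilityMeasure Ω) (_ : P ∈ 𝓟) => eLpNorm X 2 (P : Measure Ω)) P hP

lemma mem_claims_of_approx {X : Ω → ℝ} (hX : Measurable X)
    (h : ∀ ε : ℝ≥0∞, 0 < ε → ∃ Y ∈ claims 𝓟, capNorm 𝓟 (X - Y) ≤ ε) : X ∈ claims 𝓟 := by
  refine ⟨hX, fun ε hε => ?_⟩
  obtain ⟨Y, hY, hXY⟩ := h (ε / 2) (ENNReal.half_pos hε.ne')
  obtain ⟨g, hg⟩ := hY.2 (ε / 2) (ENNReal.half_pos hε.ne')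
  refine ⟨g, ?_⟩
  rw [← sub_add_sub_cancel X Y (g : Ω → ℝ)]
  exact ((capNorm_add_le 𝓟 (hX.sub hY.1) (hY.1.sub g.continuous.measurable)).trans
    (add_le_add hXY hg)).trans (ENNReal.add_halves ε).le

lemma tsum_ofReal_ne_top_ae (P : ProbabilityMeasure Ω) {Y : ℕ → Ω → ℝ}
    (hY : ∀ n, Measurable (Y n)) (hsum : ∑' n, eLpNorm (Y n) 2 (P : Measure Ω) ≠ ∞) :
    ∀ᵐ ω ∂(P : Measure Ω), ∑' n, ENNReal.ofReal (Y n ω) ≠ ∞ := by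
  have hm : Measurable fun ω => ∑' n, ENNReal.ofReal (Y n ω) :=
    Measurable.tsum fun n => (hY n).ennreal_ofReal
  have h : ∫⁻ ω, ∑' n, ENNReal.ofReal (Y n ω) ∂(P : Measure Ω) ≠ ∞ := by
    rw [lintegral_tsum fun n => (hY n).ennreal_ofReal.aemeasurable]
    refine ne_top_of_le_ne_top hsum (ENNReal.tsum_le_tsum fun n => ?_)
    calc ∫⁻ ω, ENNReal.ofReal (Y n ω) ∂(P : Measure Ω)
        ≤ eLpNorm (Y n) 1 (P : Measure Ω) := by
          rw [eLpNorm_one_eq_lintegral_enorm]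
          exact lintegral_mono fun ω => Real.ofReal_le_enorm _
      _ ≤ eLpNorm (Y n) 2 (P : Measure Ω) :=
          eLpNorm_le_eLpNorm_of_exponent_le (by norm_num) (hY n).aestronglyMeasurable
  filter_upwards [ae_lt_top hm h] with ω hω using hω.ne

/-- A series of nonnegative claims whose norms are summable is dominated by a claim, its sum. -/
lemma exists_claim_ge_partialSums {Y : ℕ → Ω → ℝ} (hY : ∀ n, Y n ∈ claims 𝓟)
    (hY0 : ∀ n ω, 0 ≤ Y n ω) (hsum : ∑' n, capNorm 𝓟 (Y n) ≠ ∞) :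
    ∃ S ∈ claims 𝓟, ∀ N, ∀ P ∈ 𝓟, ∀ᵐ ω ∂(P : Measure Ω), ∑ n ∈ Finset.range N, Y n ω ≤ S ω := by
  set S : Ω → ℝ := fun ω => (∑' n, ENNReal.ofReal (Y n ω)).toReal with hS
  have hSm : Measurable S :=
    (Measurable.tsum fun n => (hY n).1.ennreal_ofReal).ennreal_toReal
  have hsumP : ∀ P ∈ 𝓟, ∑' n, eLpNorm (Y n) 2 (P : Measure Ω) ≠ ∞ := fun P hP =>
    ne_top_of_le_ne_top hsum (ENNReal.tsum_le_tsum fun n => eLpNorm_le_capNorm_of_mem hP _)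
  have hlim : ∀ P ∈ 𝓟, ∀ᵐ ω ∂(P : Measure Ω),
      HasSum (fun n => Y n ω) (S ω) := fun P hP => by
    filter_upwards [tsum_ofReal_ne_top_ae P (fun n => (hY n).1) (hsumP P hP)] with ω hω
    have h := ENNReal.hasSum_toReal hω
    simp only [ENNReal.toReal_ofReal (hY0 _ ω)] at h
    rwa [show S ω = (∑' n, ENNReal.ofReal (Y n ω)).toReal from rfl,
      ENNReal.tsum_toReal_eq fun n => ENNReal.ofReal_ne_top,
      tsum_congr fun n => ENNReal.toReal_ofReal (hY0 n ω)]
  refine ⟨S, mem_claims_of_approx hSm fun ε hε => ?_, fun N P hP => ?_⟩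
  · obtain ⟨N, hN⟩ := ((ENNReal.tendsto_sum_nat_add _ hsum).eventually_le_const hε).exists
    refine ⟨∑ n ∈ Finset.range N, Y n, sum_mem fun n _ => hY n, iSup₂_le fun P hP => ?_⟩
    have hd : ∀ᵐ ω ∂(P : Measure Ω), Tendsto
        (fun M => (∑ n ∈ Finset.range M, Y (n + N)) ω) atTop
        (𝓝 ((S - ∑ n ∈ Finset.range N, Y n) ω)) := by
      filter_upwards [hlim P hP] with ω hω
      have h := ((hasSum_nat_add_iff' N).2 hω).tendsto_sum_nat
      simpa [Finset.sum_apply] using h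
    have hmeas : ∀ M, Measurable (∑ n ∈ Finset.range M, Y (n + N)) := fun M =>
      (sum_mem fun n _ => hY (n + N) : ∑ n ∈ Finset.range M, Y (n + N) ∈ claims 𝓟).1
    -- Fatou for the `L²(P)`-norm: the remainder is the limit of finite tail sums, whose norms are
    -- at most the tail of the capacity norms, uniformly in `P`.
    refine (Lp.eLpNorm_lim_le_liminf_eLpNorm (fun M => (hmeas M).aestronglyMeasurable) _
      hd).trans ?_
    refine Filter.liminf_le_of_le (by isBoundedDefault) fun b hb => ?_
    obtain ⟨M, hM⟩ := hb.exists
    refine hM.trans (le_trans ?_ hN)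
    refine (eLpNorm_sum_le (fun n _ => (hY _).1.aestronglyMeasurable) (by norm_num)).trans ?_
    refine le_trans (Finset.sum_le_sum fun n _ => eLpNorm_le_capNorm_of_mem hP _) ?_
    exact ENNReal.sum_le_tsum (f := fun n => capNorm 𝓟 (Y (n + N))) _
  · filter_upwards [hlim P hP] with ω hω
    exact sum_le_hasSum _ (fun n _ => hY0 n ω) hω

end AutomaticContinuity

section AutomaticContinuity

variable {Ω : Type*} [TopologicalSpace Ω] [PolishSpace Ω] [MeasurableSpace Ω] [BorelSpace Ω]
variable {𝓟 : Set (ProbabilityMeasure Ω)}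

/-- The absolute value of a claim. -/
def absClaim (X : L2 𝓟) : ClaimFun 𝓟 := ClaimFun.mk _ (abs_mem_claims (rep_mem X))

lemma isNonneg_absClaim_sub (hP : IsCompact 𝓟) (X : L2 𝓟) :
    IsNonneg (toL2 𝓟 (absClaim X) - X) := by
  have e : toL2 𝓟 (absClaim X) - X = toL2 𝓟 (absClaim X - Quotient.out X) := by
    rw [map_sub, toL2_out]
  rw [e, isNonneg_toL2 hP]
  exact fun P _ => Filter.Eventually.of_forall fun ω => sub_nonneg.2 (le_abs_self (rep X ω))

lemma isNonneg_absClaim_add (hP : IsCompact 𝓟) (X : L2 𝓟) :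
    IsNonneg (toL2 𝓟 (absClaim X) + X) := by
  have e : toL2 𝓟 (absClaim X) + X = toL2 𝓟 (absClaim X + Quotient.out X) := by
    rw [map_add, toL2_out]
  rw [e, isNonneg_toL2 hP]
  refine fun P _ => Filter.Eventually.of_forall fun ω => ?_
  have := neg_abs_le (rep X ω)
  change 0 ≤ |rep X ω| + rep X ω
  linarith

lemma abs_le_apply_absClaim (hP : IsCompact 𝓟) {φ : L2 𝓟 →ₗ[ℝ] ℝ}
    (hφ : ∀ X, IsNonneg X → 0 ≤ φ X) (X : L2 𝓟) : |φ X| ≤ φ (toL2 𝓟 (absClaim X)) := by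
  have h1 := hφ _ (isNonneg_absClaim_sub hP X)
  have h2 := hφ _ (isNonneg_absClaim_add hP X)
  rw [map_sub] at h1
  rw [map_add] at h2
  exact abs_le.2 ⟨by linarith, by linarith⟩

/-- If `φ` were unbounded, there would be nonnegative claims of norm `2⁻ⁿ` on which `φ` is at least
1. Their sum is again a claim and dominates every partial sum, so its price would exceed every
integer. -/
theorem continuous_of_nonneg (hP : IsCompact 𝓟) (φ : L2 𝓟 →ₗ[ℝ] ℝ)
    (hφ : ∀ X, IsNonneg X → 0 ≤ φ X) : Continuous φ := by
  by_contra hcont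
  have hunb : ∀ n : ℕ, ∃ X : L2 𝓟, (2 : ℝ) ^ n * ‖X‖ < ‖φ X‖ := by
    by_contra! h
    obtain ⟨n, hn⟩ := h
    exact hcont (φ.mkContinuous _ hn).continuous
  choose X hX using hunb
  have hpos : ∀ n, 0 < ‖X n‖ := fun n => by
    rw [norm_pos_iff]
    intro h0
    have := hX n
    simp [h0] at this
  set c : ℕ → ℝ := fun n => ((2 : ℝ) ^ n * ‖X n‖)⁻¹ with hc
  have hc0 : ∀ n, 0 < c n := fun n => inv_pos.2 (mul_pos (by positivity) (hpos n))
  set Y : ℕ → Ω → ℝ := fun n => ClaimFun.toFun 𝓟 (c n • absClaim (X n)) with hYdef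
  have hYcap : ∀ n, capNorm 𝓟 (Y n) = (2⁻¹ : ℝ≥0∞) ^ n := fun n => by
    have h1 : ‖c n • absClaim (X n)‖ = (2⁻¹ : ℝ) ^ n := by
      have h2 : ‖absClaim (X n)‖ = ‖X n‖ := by
        rw [norm_eq_capNorm_rep, ClaimFun.norm_def, absClaim, ClaimFun.toFun_mk, capNorm_abs]
      rw [norm_smul, h2, Real.norm_of_nonneg (hc0 n).le, hc]
      simp only
      rw [mul_inv, mul_assoc, inv_mul_cancel₀ (hpos n).ne', mul_one, inv_pow]
    rw [hYdef]
    simp only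
    rw [← ofReal_norm_claimFun, h1, ENNReal.ofReal_pow (by positivity),
      ENNReal.ofReal_inv_of_pos (by norm_num), ENNReal.ofReal_ofNat]
  have hsum : ∑' n, capNorm 𝓟 (Y n) ≠ ∞ := by
    simp_rw [hYcap]
    rw [ENNReal.tsum_geometric, ENNReal.one_sub_inv_two, inv_inv]
    exact ENNReal.ofNat_ne_top
  obtain ⟨S, hS, hSle⟩ := exists_claim_ge_partialSums (fun n => ClaimFun.toFun_mem _)
    (fun n ω => mul_nonneg (hc0 n).le (abs_nonneg (rep (X n) ω))) hsum
  have hge : ∀ n, 1 ≤ φ (toL2 𝓟 (c n • absClaim (X n))) := fun n => by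
    rw [map_smul, map_smul, smul_eq_mul]
    have h1 := (hX n).le.trans (abs_le_apply_absClaim hP hφ (X n))
    calc (1 : ℝ) = c n * (2 ^ n * ‖X n‖) :=
          (inv_mul_cancel₀ (mul_pos (by positivity) (hpos n)).ne').symm
      _ ≤ _ := mul_le_mul_of_nonneg_left h1 (hc0 n).le
  obtain ⟨N, hN⟩ := exists_nat_gt (φ (toL2 𝓟 (ClaimFun.mk S hS)))
  have hNle : 0 ≤ φ (toL2 𝓟 (ClaimFun.mk S hS - ∑ n ∈ Finset.range N, c n • absClaim (X n))) := by
    refine hφ _ ((isNonneg_toL2 hP _).2 fun P hPm => ?_)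
    filter_upwards [hSle N P hPm] with ω hω
    rw [map_sub, map_sum, Pi.sub_apply, Finset.sum_apply]
    exact sub_nonneg.2 hω
  rw [map_sub, map_sub, map_sum, map_sum] at hNle
  have h2 : (N : ℝ) ≤ ∑ n ∈ Finset.range N, φ (toL2 𝓟 (c n • absClaim (X n))) := by
    calc (N : ℝ) = ∑ n ∈ Finset.range N, (1 : ℝ) := by simp
      _ ≤ _ := Finset.sum_le_sum fun n _ => hge n
  linarith

end AutomaticContinuity

/-! ### Representation of positive functionals by densities with respect to one prior -/

section Representation

variable {Ω : Type*} [TopologicalSpace Ω] [PolishSpace Ω] [MeasurableSpace Ω] [BorelSpace Ω]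
variable {𝓟 : Set (ProbabilityMeasure Ω)}

lemma norm_ofBoundedContinuous_sq_le (f : Ω →ᵇ ℝ) {M : ℝ} (hM : 0 ≤ M)
    (h : ∀ P ∈ 𝓟, ∫ ω, f ω ^ 2 ∂(P : Measure Ω) ≤ M) : ‖ofBoundedContinuous 𝓟 f‖ ^ 2 ≤ M := by
  rw [← Real.le_sqrt (norm_nonneg _) hM, ofBoundedContinuous_eq, norm_toL2, ClaimFun.norm_def,
    ClaimFun.toFun_mk]
  refine ENNReal.toReal_le_of_le_ofReal (Real.sqrt_nonneg _) (iSup₂_le fun P hP => ?_)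
  have hf : MemLp f 2 (P : Measure Ω) :=
    MemLp.of_bound f.continuous.aestronglyMeasurable ‖f‖
      (Filter.Eventually.of_forall f.norm_coe_le_norm)
  rw [hf.eLpNorm_eq_integral_rpow_norm (by norm_num) (by norm_num)]
  refine ENNReal.ofReal_le_ofReal ?_
  rw [ENNReal.toReal_ofNat, ← one_div, ← Real.sqrt_eq_rpow]
  refine Real.sqrt_le_sqrt ((le_of_eq ?_).trans (h P hP))
  simp

/-- The second moments of finitely many functions under the priors of the hull form a convex set. -/
lemma convex_image_moments {ι : Type*} (f : ι → Ω →ᵇ ℝ) :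
    Convex ℝ ((fun (Q : ProbabilityMeasure Ω) (i : ι) => ∫ ω, (f i * f i) ω ∂(Q : Measure Ω)) ''
      closedHull 𝓟) := by
  rintro _ ⟨Q, hQ, rfl⟩ _ ⟨R, hR, rfl⟩ a b ha hb hab
  lift a to ℝ≥0 using ha
  lift b to ℝ≥0 using hb
  obtain ⟨S, hS, hS'⟩ := exists_mem_closedHull_convexCombination hQ hR
    (a := a) (b := b) (by exact_mod_cast hab)
  refine ⟨S, hS, funext fun i => ?_⟩
  have hi : ∀ (P : ProbabilityMeasure Ω), Integrable (f i * f i : Ω →ᵇ ℝ) (P : Measure Ω) :=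
    fun P => (f i * f i).integrable (P : Measure Ω)
  simp only [hS']
  rw [integral_add_measure ((hi Q).smul_measure_nnreal) ((hi R).smul_measure_nnreal),
    integral_smul_nnreal_measure, integral_smul_nnreal_measure]
  rfl

/-- Every finite family of constraints `2 L f ≤ C² + E^Q[f²]` is satisfied by a prior of the
hull. -/
lemma exists_mem_closedHull_finite (hP : IsCompact 𝓟) (hne : 𝓟.Nonempty)
    {L : (Ω →ᵇ ℝ) →ₗ[ℝ] ℝ} {C : ℝ} (hL : ∀ f, L f ≤ C * ‖ofBoundedContinuous 𝓟 f‖)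
    (s : Finset (Ω →ᵇ ℝ)) :
    ∃ Q ∈ closedHull 𝓟, ∀ f ∈ s, 2 * L f ≤ C ^ 2 + ∫ ω, (f * f) ω ∂(Q : Measure Ω) := by
  by_contra! hcon
  set T : ProbabilityMeasure Ω → s → ℝ :=
    fun Q i => ∫ ω, (i.1 * i.1) ω ∂(Q : Measure Ω) with hT
  set w : s → ℝ := fun i => 2 * L i.1 - C ^ 2 with hw
  have hTc : Continuous T := continuous_pi fun i =>
    ProbabilityMeasure.continuous_integral_boundedContinuousFunction (i.1 * i.1)
  -- If every prior violates some constraint, the compact convex set of moment vectors misses the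
  -- orthant above `w`, and the two can be strictly separated.
  have hdisj : Disjoint (T '' closedHull 𝓟) (Set.Ici w) := by
    rw [Set.disjoint_left]
    rintro _ ⟨Q, hQ, rfl⟩ hwQ
    obtain ⟨f, hf, hlt⟩ := hcon Q hQ
    have h1 := hwQ ⟨f, hf⟩
    simp only [hT, hw] at h1
    linarith
  obtain ⟨g, u, v, hgu, huv, hgv⟩ := geometric_hahn_banach_compact_closed
    (convex_image_moments fun i : s => i.1) ((isCompact_closedHull hP).image hTc)
    (convex_Ici w) isClosed_Ici hdisj
  classical
  set l : s → ℝ := fun i => g (Pi.single i 1) with hl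
  have hg : ∀ x : s → ℝ, g x = ∑ i, l i * x i := fun x => by
    conv_lhs => rw [pi_eq_sum_univ' x, map_sum]
    refine Finset.sum_congr rfl fun i _ => ?_
    rw [map_smul, smul_eq_mul, mul_comm]
  have hl0 : ∀ i, 0 ≤ l i := fun i => by
    by_contra! hi
    have hwv := hgv w Set.self_mem_Ici
    -- Moving this far along a coordinate with `l i < 0` brings `g` down to exactly `v`, although `g
    -- > v` on the orthant.
    have ht : 0 ≤ (g w - v) / (-l i) := div_nonneg (by linarith) (by linarith)
    have h1 := hgv (w + ((g w - v) / (-l i)) • Pi.single i 1) (by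
      rw [Set.mem_Ici]
      refine le_add_of_nonneg_right (smul_nonneg ht ?_)
      exact Pi.single_nonneg.2 zero_le_one)
    rw [map_add, map_smul, smul_eq_mul, show g (Pi.single i 1) = l i from rfl, div_mul_eq_mul_div,
      div_neg, mul_div_cancel_right₀ _ hi.ne] at h1
    linarith
  obtain ⟨P₀, hP₀⟩ := hne
  have hΛ : 0 < ∑ i, l i := by
    refine lt_of_le_of_ne (Finset.sum_nonneg fun i _ => hl0 i) fun h0 => ?_
    have hz : ∀ i, l i = 0 := fun i =>
      (Finset.sum_eq_zero_iff_of_nonneg fun i _ => hl0 i).1 h0.symm i (Finset.mem_univ i)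
    have h1 := hgu _ ⟨P₀, subset_closedHull hP₀, rfl⟩
    have h2 := hgv w Set.self_mem_Ici
    rw [hg] at h1 h2
    simp only [hz, zero_mul, Finset.sum_const_zero] at h1 h2
    linarith
  set Λ := ∑ i, l i with hΛdef
  set m : s → ℝ := fun i => l i / Λ with hm
  have hm0 : ∀ i, 0 ≤ m i := fun i => div_nonneg (hl0 i) hΛ.le
  have hm1 : ∑ i, m i = 1 := by rw [hm, ← Finset.sum_div, div_self hΛ.ne']
  have hmg : ∀ x : s → ℝ, ∑ i, m i * x i = g x / Λ := fun x => by
    rw [hg, Finset.sum_div]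
    exact Finset.sum_congr rfl fun i _ => by rw [hm]; ring
  -- The normalised separating weights merge the finitely many constraints into one function; by
  -- Jensen its second moments stay below the averaged ones.
  set F : Ω →ᵇ ℝ := ∑ i, m i • i.1 with hF
  have hFapp : ∀ ω, F ω = ∑ i, m i * (i.1 : Ω →ᵇ ℝ) ω := fun ω => by
    rw [hF, BoundedContinuousFunction.sum_apply]
    exact Finset.sum_congr rfl fun i _ => rfl
  have hLF : 2 * L F - C ^ 2 = g w / Λ := by
    rw [← hmg, hF, map_sum, Finset.mul_sum]
    simp only [map_smul, smul_eq_mul, hw, mul_sub, Finset.sum_sub_distrib]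
    rw [← Finset.sum_mul, hm1, one_mul]
    congr 1
    exact Finset.sum_congr rfl fun i _ => by ring
  have hFP : ∀ P ∈ 𝓟, ∫ ω, F ω ^ 2 ∂(P : Measure Ω) ≤ u / Λ := fun P hPm => by
    have hint : ∀ i : s, Integrable (fun ω => m i * (i.1 * i.1 : Ω →ᵇ ℝ) ω) (P : Measure Ω) :=
      fun i => ((i.1 * i.1 : Ω →ᵇ ℝ).integrable (P : Measure Ω)).const_mul _
    calc ∫ ω, F ω ^ 2 ∂(P : Measure Ω)
        ≤ ∫ ω, ∑ i, m i * (i.1 * i.1 : Ω →ᵇ ℝ) ω ∂(P : Measure Ω) := by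
          refine integral_mono ?_ (integrable_finsetSum _ fun i _ => hint i) fun ω => ?_
          · simp only [sq]
            exact (F * F).integrable (P : Measure Ω)
          · simp only [hFapp]
            refine (ConvexOn.map_sum_le (f := fun x : ℝ => x ^ 2) even_two.convexOn_pow
              (fun i _ => hm0 i) hm1 (fun i _ => Set.mem_univ _)).trans (le_of_eq ?_)
            exact Finset.sum_congr rfl fun i _ => by simp [sq]
      _ = g (T P) / Λ := by
          rw [integral_finsetSum _ fun i _ => hint i, ← hmg]
          exact Finset.sum_congr rfl fun i _ => integral_const_mul _ _
      _ ≤ u / Λ := by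
          gcongr
          exact (hgu _ ⟨P, subset_closedHull hPm, rfl⟩).le
  have hu : 0 ≤ u / Λ := (integral_nonneg fun ω => sq_nonneg _).trans (hFP P₀ hP₀)
  have h1 := norm_ofBoundedContinuous_sq_le F hu hFP
  have h2 := hL F
  have h3 : u / Λ < g w / Λ := by
    gcongr
    exact huv.trans (hgv w Set.self_mem_Ici)
  -- Separation gives `2 L F - C² > ‖F‖²`, whereas `2 L F ≤ 2 C ‖F‖ ≤ C² + ‖F‖²`.
  nlinarith [sq_nonneg (C - ‖ofBoundedContinuous 𝓟 F‖)]

/-- The constraints `2 L f ≤ C² + E^Q[f²]` are closed in `Q`, so compactness of the hull gives one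
`Q` satisfying all of them. Replacing `f` by `t • f` turns them into a nonnegative quadratic in `t`,
whose discriminant condition is the claim. -/
lemma exists_mem_closedHull_bound (hP : IsCompact 𝓟) (hne : 𝓟.Nonempty)
    {L : (Ω →ᵇ ℝ) →ₗ[ℝ] ℝ} {C : ℝ} (hL : ∀ f, L f ≤ C * ‖ofBoundedContinuous 𝓟 f‖) :
    ∃ Q ∈ closedHull 𝓟, ∀ f, L f ^ 2 ≤ C ^ 2 * ∫ ω, (f * f) ω ∂(Q : Measure Ω) := by
  obtain ⟨Q, hQ, hQ'⟩ := (isCompact_closedHull hP).inter_iInter_nonempty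
    (fun f : Ω →ᵇ ℝ => {Q : ProbabilityMeasure Ω |
      2 * L f ≤ C ^ 2 + ∫ ω, (f * f) ω ∂(Q : Measure Ω)})
    (fun f => isClosed_le continuous_const (continuous_const.add
      (ProbabilityMeasure.continuous_integral_boundedContinuousFunction (f * f))))
    (fun s => by
      obtain ⟨Q, hQ, hQs⟩ := exists_mem_closedHull_finite hP hne hL s
      exact ⟨Q, hQ, Set.mem_iInter₂.2 hQs⟩)
  refine ⟨Q, hQ, fun f => ?_⟩
  have h : ∀ t : ℝ, 0 ≤ (∫ ω, (f * f) ω ∂(Q : Measure Ω)) * (t * t) + (-(2 * L f)) * t + C ^ 2 := by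
    intro t
    have h1 := Set.mem_iInter.1 hQ' (t • f)
    have h2 : ∫ ω, (t • f * t • f : Ω →ᵇ ℝ) ω ∂(Q : Measure Ω) =
        (t * t) * ∫ ω, (f * f) ω ∂(Q : Measure Ω) := by
      rw [← integral_const_mul]
      refine integral_congr_ae (Filter.Eventually.of_forall fun ω => ?_)
      simp
      ring
    simp only [Set.mem_ofPred_eq, map_smul, smul_eq_mul, h2] at h1
    linarith
  have := discrim_le_zero h
  rw [discrim] at this
  linarith

/-- A vector of `L²(Q)` that integrates nonnegatively against nonnegative bounded continuous
functions is nonnegative. -/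
lemma ae_nonneg_of_forall_inner_nonneg {Q : ProbabilityMeasure Ω} (z : Lp ℝ 2 (Q : Measure Ω))
    (hz : ∀ f : Ω →ᵇ ℝ, 0 ≤ f →
      0 ≤ inner ℝ z (BoundedContinuousFunction.toLp 2 (Q : Measure Ω) ℝ f)) :
    0 ≤ᵐ[(Q : Measure Ω)] z := by
  have hd := BoundedContinuousFunction.toLp_denseRange ℝ (Q : Measure Ω) ℝ (p := 2) (by norm_num)
  -- The absolute value is continuous on `L²(Q)`, so positivity spreads by density to all `|g|`, in
  -- particular to indicators.
  have habs : ∀ g : Lp ℝ 2 (Q : Measure Ω), 0 ≤ inner ℝ z |g| := by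
    refine fun g => hd.induction_on (p := fun g => 0 ≤ inner ℝ z |g|) g
      (isClosed_le continuous_const 
        (continuous_const.inner (continuous_id.sup continuous_neg))) fun f => ?_
    have e : |BoundedContinuousFunction.toLp 2 (Q : Measure Ω) ℝ f| =
        BoundedContinuousFunction.toLp 2 (Q : Measure Ω) ℝ |f| := by
      apply Lp.ext
      filter_upwards [Lp.coeFn_abs (BoundedContinuousFunction.toLp 2 (Q : Measure Ω) ℝ f),
        BoundedContinuousFunction.coeFn_toLp 2 (Q : Measure Ω) ℝ f,
        BoundedContinuousFunction.coeFn_toLp 2 (Q : Measure Ω) ℝ |f|] with ω h1 h2 h3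
      rw [h1, h2, h3]
      rfl
    rw [e]
    exact hz _ (abs_nonneg f)
  refine ae_nonneg_of_forall_setIntegral_nonneg
    ((Lp.memLp z).integrable (by norm_num)) fun s hs hfin => ?_
  have h1 := habs (indicatorConstLp 2 hs hfin.ne (1 : ℝ))
  rw [abs_of_nonneg, real_inner_comm, L2.inner_indicatorConstLp_one] at h1
  · exact h1
  · rw [← Lp.coeFn_nonneg]
    filter_upwards [indicatorConstLp_coeFn (p := 2) (hs := hs) (hμs := hfin.ne) (c := (1 : ℝ))]
      with ω hω
    rw [hω]
    exact Set.indicator_nonneg (fun _ _ => zero_le_one) ω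

/-- The bound lets `φ`, restricted to bounded continuous functions, extend to `L²(Q)`. Its Riesz
vector is the density, and the identity reaches all of `L2 𝓟` since bounded continuous functions are
dense there too. -/
theorem exists_density_of_bound (hP : IsCompact 𝓟) {Q : ProbabilityMeasure Ω}
    (hQ : Q ∈ closedHull 𝓟) (φ : L2 𝓟 →L[ℝ] ℝ) (hφ : ∀ X, IsNonneg X → 0 ≤ φ X) {C : ℝ}
    (hC : 0 ≤ C) (hQL : ∀ f, φ (ofBoundedContinuous 𝓟 f) ^ 2 ≤
      C ^ 2 * ∫ ω, (f * f) ω ∂(Q : Measure Ω)) :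
    ∃ Z, IsDensity Q Z ∧ ∀ X, φ X = linearPrice Q Z X := by
  set L : (Ω →ᵇ ℝ) →ₗ[ℝ] ℝ := φ.toLinearMap ∘ₗ ofBoundedContinuous 𝓟 with hLdef
  set e : (Ω →ᵇ ℝ) →L[ℝ] Lp ℝ 2 (Q : Measure Ω) :=
    BoundedContinuousFunction.toLp 2 (Q : Measure Ω) ℝ with he
  have hd : DenseRange e :=
    BoundedContinuousFunction.toLp_denseRange ℝ (Q : Measure Ω) ℝ (p := 2) (by norm_num)
  have heae : ∀ f, e f =ᵐ[(Q : Measure Ω)] f := fun f =>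
    BoundedContinuousFunction.coeFn_toLp 2 (Q : Measure Ω) ℝ f
  have hnorm : ∀ f, ‖L f‖ ≤ C * ‖e f‖ := fun f => by
    refine abs_le.2 (abs_le_of_sq_le_sq' ?_ (mul_nonneg hC (norm_nonneg (e f))))
    refine (hQL f).trans (le_of_eq ?_)
    rw [mul_pow, ← real_inner_self_eq_norm_sq (e f), L2.inner_def]
    congr 1
    refine integral_congr_ae ?_
    filter_upwards [heae f] with ω hω
    rw [hω]
    simp [sq]
  set z : Lp ℝ 2 (Q : Measure Ω) :=
    (InnerProductSpace.toDual ℝ _).symm (L.extendOfNorm e.toLinearMap) with hz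
  have hzL : ∀ f, inner ℝ z (e f) = L f := fun f => by
    rw [hz, InnerProductSpace.toDual_symm_apply]
    exact LinearMap.extendOfNorm_eq (e := e.toLinearMap) hd ⟨_, hnorm⟩ f
  have hz0 : 0 ≤ᵐ[(Q : Measure Ω)] z := by
    refine ae_nonneg_of_forall_inner_nonneg z fun f hf => ?_
    rw [← he, hzL]
    exact hφ _ ((isNonneg_toL2 hP _).2 fun P _ => Filter.Eventually.of_forall hf)
  have hdens : IsDensity Q z := ⟨Lp.memLp z, hz0⟩
  refine ⟨z, hdens, fun X => ?_⟩
  rw [← linearPriceCLM_apply hP hQ hdens]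
  refine congrFun (denseRange_ofBoundedContinuous.equalizer φ.continuous
    (linearPriceCLM hP hQ hdens).continuous (funext fun f => ?_)) X
  have h1 : toLpHull hP hQ (ofBoundedContinuous 𝓟 f) = e f := by
    apply Lp.ext
    rw [ofBoundedContinuous_eq]
    filter_upwards [toLpHull_ae hP hQ (toL2 𝓟 (ClaimFun.mk f (boundedContinuous_mem_claims f))),
      rep_toL2_ae hP hQ (ClaimFun.mk f (boundedContinuous_mem_claims f)), heae f] with ω h1 h2 h3
    rw [h1, h2, h3, ClaimFun.toFun_mk]
  simp only [Function.comp_apply, linearPriceCLM, ContinuousLinearMap.comp_apply, h1,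
    innerSL_apply_apply, Lp.toLp_coeFn, hzL]
  rfl

/-- Every positive continuous functional is dominated by the `L²`-norm of a prior of the hull. -/
lemma exists_mem_closedHull_sq_le (hP : IsCompact 𝓟) (hne : 𝓟.Nonempty) (φ : L2 𝓟 →L[ℝ] ℝ) :
    ∃ Q ∈ closedHull 𝓟, ∀ f, φ (ofBoundedContinuous 𝓟 f) ^ 2 ≤
      ‖φ‖ ^ 2 * ∫ ω, (f * f) ω ∂(Q : Measure Ω) :=
  exists_mem_closedHull_bound hP hne (L := φ.toLinearMap ∘ₗ ofBoundedContinuous 𝓟)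
    (fun _ => (le_abs_self _).trans (φ.le_opNorm _))

variable (𝓟) in
/-- The priors of the hull that represent a functional by a density. -/
def representingPriors (φ : L2 𝓟 →L[ℝ] ℝ) : Set (ProbabilityMeasure Ω) :=
  {Q | Q ∈ closedHull 𝓟 ∧ ∃ Z, IsDensity Q Z ∧ ∀ X, φ X = linearPrice Q Z X}

lemma representingPriors_nonempty (hP : IsCompact 𝓟) (hne : 𝓟.Nonempty) (φ : L2 𝓟 →L[ℝ] ℝ)
    (hφ : ∀ X, IsNonneg X → 0 ≤ φ X) : (representingPriors 𝓟 φ).Nonempty := by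
  obtain ⟨Q, hQ, hQL⟩ := exists_mem_closedHull_sq_le hP hne φ
  exact ⟨Q, hQ, exists_density_of_bound hP hQ φ hφ (norm_nonneg φ) hQL⟩

/-- If there are two priors, every positive continuous functional is represented by infinitely
many priors of the hull. -/
lemma infinite_representingPriors (hP : IsCompact 𝓟) (hnt : 𝓟.Nontrivial) (φ : L2 𝓟 →L[ℝ] ℝ)
    (hφ : ∀ X, IsNonneg X → 0 ≤ φ X) : (representingPriors 𝓟 φ).Infinite := by
  obtain ⟨Q, hQ, hQL⟩ := exists_mem_closedHull_sq_le hP hnt.nonempty φ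
  obtain ⟨R, hR, hRQ⟩ := hnt.exists_ne Q
  -- The mixtures of `Q` and `R ≠ Q` with these weights are pairwise distinct, and each gives `Q`
  -- positive weight, so it still dominates the functional.
  have hab : ∀ n : ℕ, (((n : ℝ≥0) + 1) / (n + 2)) + 1 / (n + 2) = 1 := fun n => by
    rw [← add_div, add_assoc, one_add_one_eq_two, div_self (by positivity)]
  choose S hS hSeq using fun n : ℕ =>
    exists_mem_closedHull_convexCombination hQ (subset_closedHull hR) (hab n)
  refine Set.infinite_of_injective_forall_mem (f := S) (fun n m hnm => ?_) fun n => ⟨hS n, ?_⟩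
  · obtain ⟨s, hs, hne⟩ : ∃ s, MeasurableSet s ∧ (Q : Measure Ω) s ≠ (R : Measure Ω) s := by
      by_contra! h
      exact hRQ (Subtype.ext (Measure.ext fun s hs => (h s hs).symm))
    have hreal : ∀ k : ℕ, (S k : Measure Ω).real s = ((k : ℝ) + 1) / (k + 2) *
        (Q : Measure Ω).real s + 1 / (k + 2) * (R : Measure Ω).real s := fun k => by
      rw [hSeq k, measureReal_add_apply, measureReal_nnreal_smul_apply,
        measureReal_nnreal_smul_apply]
      simp
    have hne' : (R : Measure Ω).real s - (Q : Measure Ω).real s ≠ 0 := fun h =>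
      hne ((measureReal_eq_measureReal_iff).1 (sub_eq_zero.1 h).symm)
    have h1 := (hreal n).symm.trans ((congrArg (fun P : ProbabilityMeasure Ω =>
      (P : Measure Ω).real s) hnm).trans (hreal m))
    have h2 : ∀ k : ℕ, ((k : ℝ) + 1) / (k + 2) = 1 - 1 / (k + 2) := fun k => by
      field_simp
      ring
    rw [h2, h2] at h1
    have h3 : (1 / ((n : ℝ) + 2) - 1 / (m + 2)) *
        ((R : Measure Ω).real s - (Q : Measure Ω).real s) = 0 := by linarith
    have h4 := sub_eq_zero.1 ((mul_eq_zero.1 h3).resolve_right hne')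
    rw [one_div, one_div, inv_inj] at h4
    exact_mod_cast add_right_cancel h4
  -- The factor under the root is the inverse of the weight of `Q` in `S n`.
  · refine exists_density_of_bound hP (hS n) φ hφ
      (C := ‖φ‖ * Real.sqrt ((n + 2) / (n + 1))) (by positivity) fun f => ?_
    refine (hQL f).trans ?_
    have hi : ∀ P : ProbabilityMeasure Ω, Integrable (f * f : Ω →ᵇ ℝ) (P : Measure Ω) :=
      fun P => (f * f).integrable (P : Measure Ω)
    have hR0 : 0 ≤ ∫ ω, (f * f) ω ∂(R : Measure Ω) := integral_nonneg fun ω => mul_self_nonneg (f ω)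
    rw [mul_pow, Real.sq_sqrt (by positivity), hSeq n,
      integral_add_measure ((hi Q).smul_measure_nnreal) ((hi R).smul_measure_nnreal),
      integral_smul_nnreal_measure, integral_smul_nnreal_measure, mul_assoc]
    refine mul_le_mul_of_nonneg_left ?_ (sq_nonneg _)
    simp only [NNReal.smul_def, NNReal.coe_div, NNReal.coe_add, NNReal.coe_natCast,
      NNReal.coe_one, NNReal.coe_ofNat, smul_eq_mul]
    rw [mul_add, ← mul_assoc, div_mul_div_cancel₀ (by positivity), div_self (by positivity),
      one_mul]
    exact le_add_of_nonneg_right (by positivity)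

end Representation

/-! ### Separability of the space of claims -/

section PlateauFunctions

variable {X : Type*} [PseudoMetricSpace X]

/-- The continuous function that is `c` on the ball of radius `r` around `y`, and `d` outside the
ball of radius `2 r`. -/
def plateau (y : X) (r c d : ℝ) : X →ᵇ ℝ :=
  BoundedContinuousFunction.ofNormedAddCommGroup
    (fun x => d + (c - d) * max 0 (min 1 (2 - dist x y / r))) (by fun_prop) (|d| + |c - d|)
    (fun x => by
      have h0 : 0 ≤ max 0 (min 1 (2 - dist x y / r)) := le_max_left _ _
      have h1 : max 0 (min 1 (2 - dist x y / r)) ≤ 1 := max_le zero_le_one (min_le_left _ _)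
      refine (norm_add_le _ _).trans (add_le_add le_rfl ?_)
      rw [norm_mul, Real.norm_eq_abs, Real.norm_of_nonneg h0]
      exact mul_le_of_le_one_right (abs_nonneg _) h1)

lemma plateau_apply (y : X) (r c d : ℝ) (x : X) :
    plateau y r c d x = d + (c - d) * max 0 (min 1 (2 - dist x y / r)) := rfl

lemma plateau_le {y : X} {r c d : ℝ} (hcd : d ≤ c) (x : X) : plateau y r c d x ≤ c := by
  have h1 : max 0 (min 1 (2 - dist x y / r)) ≤ 1 := max_le zero_le_one (min_le_left _ _)
  rw [plateau_apply]
  nlinarith [mul_le_mul_of_nonneg_left h1 (sub_nonneg.2 hcd)]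

lemma plateau_eq_of_near {y : X} {r c d : ℝ} (hr : 0 < r) {x : X} (hx : dist x y ≤ r) :
    plateau y r c d x = c := by
  have h : dist x y / r ≤ 1 := (div_le_one hr).2 hx
  rw [plateau_apply, min_eq_left (by linarith), max_eq_right zero_le_one]
  ring

lemma plateau_eq_of_far {y : X} {r c d : ℝ} (hr : 0 < r) {x : X} (hx : 2 * r ≤ dist x y) :
    plateau y r c d x = d := by
  have h : 2 ≤ dist x y / r := (le_div_iff₀ hr).2 hx
  rw [plateau_apply, max_eq_left ((min_le_right _ _).trans (by linarith))]
  ring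

/-- A bounded continuous function is the supremum of the plateau functions with rational
parameters below it. -/
lemma exists_plateau_le {u : ℕ → X} (hu : DenseRange u) (f : X →ᵇ ℝ) (x : X) {ε : ℝ}
    (hε : 0 < ε) : ∃ i : ℕ × ℚ × ℚ × ℚ,
      (∀ y, plateau (u i.1) i.2.1 i.2.2.1 i.2.2.2 y ≤ f y) ∧
      f x - ε < plateau (u i.1) i.2.1 i.2.2.1 i.2.2.2 x := by
  -- The outer value `d` lies below `f` everywhere. The radius below, less than `δ / 3`, keeps the
  -- doubled ball around `u n` within `δ` of `x`, where `f > c`.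
  obtain ⟨d, -, hd⟩ := exists_rat_btwn (sub_one_lt (-‖f‖))
  have hdf : ∀ y, (d : ℝ) < f y := fun y => hd.trans_le (f.neg_norm_le_apply y)
  obtain ⟨c, hc, hcf⟩ := exists_rat_btwn
    (show max (f x - ε) d < f x from max_lt (by linarith) (hdf x))
  obtain ⟨δ, hδ, hball⟩ := Metric.eventually_nhds_iff.1
    (f.continuous.continuousAt.eventually (lt_mem_nhds hcf))
  obtain ⟨r, hr, hrδ⟩ := exists_rat_btwn (show (0 : ℝ) < δ / 3 by positivity)
  obtain ⟨n, hn⟩ := hu.exists_dist_lt x hr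
  have hdc : (d : ℝ) ≤ c := ((le_max_right _ _).trans_lt hc).le
  refine ⟨(n, r, c, d), fun y => ?_, ?_⟩
  · rcases le_or_gt (2 * (r : ℝ)) (dist y (u n)) with h | h
    · simp only [plateau_eq_of_far hr h]
      exact (hdf y).le
    · refine (plateau_le hdc y).trans (hball ?_).le
      have := dist_triangle y (u n) x
      rw [dist_comm (u n) x] at this
      linarith
  · simp only [plateau_eq_of_near hr hn.le]
    exact (le_max_left _ _).trans_lt hc

end PlateauFunctions

section Separable

variable {Ω : Type*} [TopologicalSpace Ω] [PolishSpace Ω] [MeasurableSpace Ω] [BorelSpace Ω]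
variable {𝓟 : Set (ProbabilityMeasure Ω)}

lemma exists_countable_family_below [Nonempty Ω] :
    ∃ g : ℕ × ℚ × ℚ × ℚ → Ω →ᵇ ℝ, ∀ (f : Ω →ᵇ ℝ) (x : Ω) (ε : ℝ), 0 < ε →
      ∃ i, g i ≤ f ∧ f x - ε < g i x := by
  let : MetricSpace Ω := TopologicalSpace.metrizableSpaceMetric Ω
  exact ⟨fun i => plateau (TopologicalSpace.denseSeq Ω i.1) i.2.1 i.2.2.1 i.2.2.2,
    fun f x ε hε => exists_plateau_le (TopologicalSpace.denseRange_denseSeq Ω) f x hε⟩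

/-- Increasing nets of bounded continuous functions with a continuous pointwise limit converge in
the capacity norm. -/
lemma exists_norm_sub_lt_of_monotone (hP : IsCompact 𝓟) {ι : Type*} [Preorder ι]
    [(atTop : Filter ι).NeBot] [(atTop : Filter ι).IsCountablyGenerated]
    {F : ι → Ω →ᵇ ℝ} {f : Ω →ᵇ ℝ}
    (hF : Monotone F) (hFf : ∀ i, F i ≤ f)
    (hlim : ∀ ω, Tendsto (fun i => F i ω) atTop (𝓝 (f ω))) {ε : ℝ} (hε : 0 < ε) :
    ∃ i, ‖ofBoundedContinuous 𝓟 f - ofBoundedContinuous 𝓟 (F i)‖ < ε := by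
  obtain ⟨i₀⟩ := Filter.nonempty_of_neBot (atTop : Filter ι)
  set G : ι → ProbabilityMeasure Ω → ℝ :=
    fun i P => ∫ ω, ((f - F i) * (f - F i)) ω ∂(P : Measure Ω) with hG
  have hGc : ∀ i, Continuous (G i) := fun i =>
    ProbabilityMeasure.continuous_integral_boundedContinuousFunction _
  have hsq : ∀ {i j}, i ≤ j → ∀ ω, ((f - F j) * (f - F j)) ω ≤ ((f - F i) * (f - F i)) ω := by
    intro i j hij ω
    have h1 : F i ω ≤ F j ω := hF hij ω
    have h2 : F j ω ≤ f ω := hFf j ω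
    simp only [BoundedContinuousFunction.mul_apply, BoundedContinuousFunction.sub_apply]
    exact mul_self_le_mul_self (by linarith) (by linarith)
  have hGanti : ∀ P : ProbabilityMeasure Ω, Antitone (G · P) := fun P i j hij =>
    integral_mono ((_ : Ω →ᵇ ℝ).integrable _) ((_ : Ω →ᵇ ℝ).integrable _) (hsq hij)
  have hGlim : ∀ P : ProbabilityMeasure Ω, Tendsto (G · P) atTop (𝓝 0) := fun P => by
    rw [← integral_zero Ω ℝ (μ := (P : Measure Ω))]
    refine tendsto_integral_filter_of_dominated_convergence
      (fun ω => ((f - F i₀) * (f - F i₀)) ω) ?_ ?_ ((_ : Ω →ᵇ ℝ).integrable _) ?_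
    · exact Filter.Eventually.of_forall fun i =>
        (BoundedContinuousFunction.continuous _).aestronglyMeasurable
    · filter_upwards [Filter.eventually_ge_atTop i₀] with i hi
      refine Filter.Eventually.of_forall fun ω => ?_
      exact (le_of_eq (Real.norm_of_nonneg (mul_self_nonneg ((f - F i) ω)))).trans (hsq hi ω)
    · refine Filter.Eventually.of_forall fun ω => ?_
      have h1 : Tendsto (fun i => f ω - F i ω) atTop (𝓝 0) := by
        simpa using (hlim ω).const_sub (f ω)
      simpa using h1.mul h1
  -- Dini's theorem on the compact set of priors turns pointwise convergence of the second moments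
  -- into uniform convergence.
  have hunif := Antitone.tendstoUniformlyOn_of_forall_tendsto hP (fun i => (hGc i).continuousOn)
    (fun P _ => hGanti P) (f := fun _ => 0) continuousOn_const fun P _ => hGlim P
  rw [Metric.tendstoUniformlyOn_iff] at hunif
  obtain ⟨i, hi⟩ := (hunif ((ε / 2) ^ 2) (by positivity)).exists
  refine ⟨i, ?_⟩
  rw [← map_sub]
  have h1 : ‖ofBoundedContinuous 𝓟 (f - F i)‖ ^ 2 ≤ (ε / 2) ^ 2 := by
    refine norm_ofBoundedContinuous_sq_le _ (by positivity) fun P hPm => ?_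
    have h2 := hi P hPm
    rw [dist_comm, Real.dist_0_eq_abs] at h2
    refine le_trans (le_of_eq ?_) ((le_abs_self _).trans h2.le)
    simp only [hG, sq]
    rfl
  calc _ ≤ ε / 2 := le_of_sq_le_sq h1 (by positivity)
    _ < ε := half_lt_self hε

/-- Every bounded continuous `f` is the pointwise supremum of those members of a fixed countable
family that lie below it. Finite suprema of the family are still countably many and increase to `f`,
hence converge to it in capacity norm. -/
theorem separableSpace_L2 (hP : IsCompact 𝓟) (hne : 𝓟.Nonempty) :
    TopologicalSpace.SeparableSpace (L2 𝓟) := by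
  have : Nonempty Ω := hne.some.nonempty
  obtain ⟨g, hg⟩ := exists_countable_family_below (Ω := Ω)
  let F : (ℕ × ℚ × ℚ × ℚ) × Finset (ℕ × ℚ × ℚ × ℚ) → Ω →ᵇ ℝ := fun p =>
    (insert p.1 p.2).sup' (Finset.insert_nonempty _ _) g
  refine ⟨Set.range fun p => ofBoundedContinuous 𝓟 (F p), Set.countable_range _, ?_⟩
  refine Dense.of_closure (denseRange_ofBoundedContinuous.mono ?_)
  rintro _ ⟨f, rfl⟩
  rw [Metric.mem_closure_iff]
  intro ε hε
  let ι := {i : ℕ × ℚ × ℚ × ℚ // g i ≤ f}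
  obtain ⟨ω₀⟩ := this
  -- A fixed member below `f`, so that the supremum over an empty finite set is also defined and
  -- below `f`.
  obtain ⟨m, hm, -⟩ := hg f ω₀ 1 one_pos
  let G : Finset ι → Ω →ᵇ ℝ := fun s => F (m, s.map ⟨Subtype.val, Subtype.val_injective⟩)
  have hGf : ∀ s, G s ≤ f := fun s => by
    refine Finset.sup'_le _ _ fun i hi => ?_
    rcases Finset.mem_insert.1 hi with rfl | hi
    · exact hm
    · obtain ⟨j, -, rfl⟩ := Finset.mem_map.1 hi
      exact j.2
  have hGmono : Monotone G := fun s t hst =>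
    Finset.sup'_mono g (Finset.insert_subset_insert m (Finset.map_subset_map.2 hst)) _
  obtain ⟨s, hs⟩ := exists_norm_sub_lt_of_monotone (𝓟 := 𝓟) hP hGmono hGf (fun ω => by
    refine tendsto_order.2 ⟨fun a ha => ?_, fun a ha =>
      Filter.Eventually.of_forall fun s => (hGf s ω).trans_lt ha⟩
    obtain ⟨i, hi, hai⟩ := hg f ω (f ω - a) (sub_pos.2 ha)
    rw [sub_sub_cancel] at hai
    filter_upwards [Filter.eventually_ge_atTop {(⟨i, hi⟩ : ι)}] with s hs
    refine hai.trans_le ?_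
    have hmem : i ∈ insert m (s.map ⟨Subtype.val, Subtype.val_injective⟩) :=
      Finset.mem_insert_of_mem (Finset.mem_map.2 ⟨⟨i, hi⟩, hs (Finset.mem_singleton_self _), rfl⟩)
    have h : g i ≤ G s := Finset.le_sup' g hmem
    exact h ω) hε
  exact ⟨_, ⟨_, rfl⟩, by rwa [dist_eq_norm]⟩

end Separable

/-! ### Countable subsets of functionals dense for pointwise convergence -/

section WeakStar

open TopologicalSpace

variable {E : Type*} [NormedAddCommGroup E] [NormedSpace ℝ E]

lemma exists_countable_subset_approx {T Y : Type*} [TopologicalSpace Y]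
    [PseudoMetrizableSpace Y] [SecondCountableTopology Y]
    (e : T → Y) (D : Set T) :
    ∃ D' ⊆ D, D'.Countable ∧ ∀ a ∈ D, e a ∈ closure (e '' D') := by
  obtain ⟨t, htD, htc, htd⟩ :=
    (IsSeparable.of_separableSpace (e '' D)).exists_countable_dense_subset
  have hsub : ∀ y : t, ∃ a ∈ D, e a = y := fun y => htD y.2
  choose s hsD hs using hsub
  have := htc.to_subtype
  refine ⟨Set.range s, Set.range_subset_iff.2 hsD, Set.countable_range s, fun a ha => ?_⟩
  refine closure_mono ?_ (htd ⟨a, ha, rfl⟩)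
  exact fun y hy => ⟨s ⟨y, hy⟩, ⟨_, rfl⟩, hs ⟨y, hy⟩⟩

/-- Over a separable space, every set of continuous linear functionals has a countable subset that
is dense in it for pointwise convergence. -/
theorem exists_countable_weakly_dense [SeparableSpace E] (D : Set (E →L[ℝ] ℝ)) :
    ∃ D' ⊆ D, D'.Countable ∧
      ∀ φ ∈ D, ∀ x : E, ∀ ε > 0, ∃ φ' ∈ D', |φ' x - φ x| < ε := by
  -- Functionals are viewed in the second countable space `ℕ → ℝ` by their values on a dense
  -- sequence. Cutting `D` into norm-bounded pieces makes closeness at a nearby dense point imply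
  -- closeness at `x`.
  have h : ∀ k : ℕ, ∃ D' ⊆ {φ ∈ D | ‖φ‖ ≤ k}, D'.Countable ∧
      ∀ φ ∈ {φ ∈ D | ‖φ‖ ≤ k}, (fun n => φ (denseSeq E n)) ∈
        closure ((fun φ : E →L[ℝ] ℝ => fun n => φ (denseSeq E n)) '' D') := fun k =>
    exists_countable_subset_approx _ _
  choose D' hD' hc hcl using h
  refine ⟨⋃ k, D' k, Set.iUnion_subset fun k => (hD' k).trans (Set.sep_subset _ _),
    Set.countable_iUnion hc, fun φ hφ x ε hε => ?_⟩
  obtain ⟨k, hk⟩ := exists_nat_ge ‖φ‖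
  obtain ⟨n, hn⟩ := (denseRange_denseSeq E).exists_dist_lt x
    (show 0 < ε / (4 * (k + 1)) by positivity)
  have hop : IsOpen {v : ℕ → ℝ | |v n - φ (denseSeq E n)| < ε / 4} :=
    isOpen_lt (by fun_prop) continuous_const
  obtain ⟨_, hv, φ', hφ', rfl⟩ := mem_closure_iff.1 (hcl k φ ⟨hφ, hk⟩) _ hop (by
    simp only [Set.mem_ofPred_eq, sub_self, abs_zero]; positivity)
  refine ⟨φ', Set.mem_iUnion.2 ⟨k, hφ'⟩, ?_⟩
  simp only [Set.mem_ofPred_eq] at hv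
  have hbound : ∀ χ : E →L[ℝ] ℝ, ‖χ‖ ≤ k → |χ x - χ (denseSeq E n)| ≤ ε / 4 := fun χ hχ => by
    rw [← map_sub, ← Real.norm_eq_abs]
    refine (χ.le_opNorm _).trans ?_
    rw [← dist_eq_norm]
    calc ‖χ‖ * dist x (denseSeq E n) ≤ (k + 1) * (ε / (4 * (k + 1))) := by
          gcongr
          linarith
      _ = ε / 4 := by field_simp
  have h1 := abs_le.1 (hbound φ' (hD' k hφ').2)
  have h2 := abs_le.1 (hbound φ hk)
  have h3 := abs_lt.1 hv
  exact abs_lt.2 ⟨by linarith, by linarith⟩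

end WeakStar

/-! ### Suprema of positive functionals are coherent prices -/

/-- A sequence of infinite sets has an injective selection. -/
lemma exists_injective_selection {α : Type*} {S : ℕ → Set α} (hS : ∀ n, (S n).Infinite) :
    ∃ q : ℕ → α, Function.Injective q ∧ ∀ n, q n ∈ S n := by
  classical
  -- With `n + 1` candidates for index `n`, Hall's condition holds: a finite `s` has at most `max s
  -- + 1` elements, the size of `T (max s)` alone.
  choose T hTS hT using fun n => (hS n).exists_subset_card_eq (n + 1)
  obtain ⟨q, hq, hqT⟩ := (Finset.all_card_le_biUnion_card_iff_exists_injective T).1 fun s => by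
    rcases s.eq_empty_or_nonempty with rfl | hs
    · simp
    · calc s.card ≤ (Finset.range (s.max' hs + 1)).card := Finset.card_le_card fun i hi =>
            Finset.mem_range.2 (Nat.lt_succ_of_le (s.le_max' i hi))
        _ = (T (s.max' hs)).card := by rw [Finset.card_range, hT]
        _ ≤ _ := Finset.card_le_card (Finset.subset_biUnion_of_mem T (s.max'_mem hs))
  exact ⟨q, hq, fun n => hTS n (hqT n)⟩

section PriceSpace

variable {Ω : Type*} [TopologicalSpace Ω] [PolishSpace Ω] [MeasurableSpace Ω] [BorelSpace Ω]
variable {𝓟 : Set (ProbabilityMeasure Ω)}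

/-- The price space attaches one density to each prior, so different functionals need different
priors. A countable dense part of `D` has the same suprema, and the infinitely many representing
priors leave room for an injective choice. -/
theorem mem_priceSpace_of_isLUB (hP : IsCompact 𝓟) (hnt : 𝓟.Nontrivial)
    {D : Set (L2 𝓟 →L[ℝ] ℝ)} (hD : D.Nonempty) (hpos : ∀ φ ∈ D, ∀ X, IsNonneg X → 0 ≤ φ X)
    {Ψ : L2 𝓟 → ℝ} (hΨ : ∀ X, IsLUB ((fun φ : L2 𝓟 →L[ℝ] ℝ => φ X) '' D) (Ψ X)) :
    Ψ ∈ priceSpace 𝓟 := by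
  have := separableSpace_L2 hP hnt.nonempty
  obtain ⟨D', hD', hc, hdense⟩ := exists_countable_weakly_dense D
  have hne : D'.Nonempty := by
    obtain ⟨φ, hφ⟩ := hD
    obtain ⟨φ', hφ', -⟩ := hdense φ hφ 0 1 one_pos
    exact ⟨φ', hφ'⟩
  obtain ⟨φ, rfl⟩ := hc.exists_eq_range hne
  have hφD : ∀ n, φ n ∈ D := fun n => hD' ⟨n, rfl⟩
  obtain ⟨q, hq, hqS⟩ := exists_injective_selection fun n =>
    infinite_representingPriors hP hnt (φ n) (hpos _ (hφD n))
  choose z hz hzX using fun n => (hqS n).2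
  have hinv : ∀ n, Function.invFun q (q n) = n := Function.leftInverse_invFun hq
  refine ⟨Set.range q, fun P => z (Function.invFun q P), Set.range_nonempty q, ?_, ?_, fun X => ?_⟩
  · rintro _ ⟨n, rfl⟩
    exact (hqS n).1
  · rintro _ ⟨n, rfl⟩
    simp only [hinv]
    exact hz n
  · have himg : (fun P => linearPrice P (z (Function.invFun q P)) X) '' Set.range q =
        Set.range fun n => φ n X := by
      rw [← Set.range_comp]
      refine congrArg Set.range (funext fun n => ?_)
      simp only [Function.comp_apply, hinv, hzX]
    rw [himg]
    refine ⟨?_, fun b hb => (hΨ X).2 ?_⟩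
    · rintro _ ⟨n, rfl⟩
      exact (hΨ X).1 ⟨_, hφD n, rfl⟩
    · rintro _ ⟨χ, hχ, rfl⟩
      refine le_of_forall_pos_le_add fun ε hε => ?_
      obtain ⟨_, ⟨n, rfl⟩, hn⟩ := hdense χ hχ X ε hε
      have h1 : φ n X ≤ b := hb ⟨n, rfl⟩
      have h2 := (abs_lt.1 hn).1
      simp only
      linarith

/-- A coherent price is a pointwise supremum of positive continuous functionals. -/
lemma exists_functionals_of_mem_priceSpace (hP : IsCompact 𝓟) {Ψ : L2 𝓟 → ℝ}
    (hΨ : Ψ ∈ priceSpace 𝓟) :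
    ∃ D : Set (L2 𝓟 →L[ℝ] ℝ), D.Nonempty ∧ (∀ φ ∈ D, ∀ X, IsNonneg X → 0 ≤ φ X) ∧
      ∀ X, IsLUB ((fun φ : L2 𝓟 →L[ℝ] ℝ => φ X) '' D) (Ψ X) := by
  obtain ⟨A, Z, hA, hAk, hZ, hlub⟩ := hΨ
  let φ : A → L2 𝓟 →L[ℝ] ℝ := fun P => linearPriceCLM hP (hAk P.2) (hZ P.1 P.2)
  have := hA.to_subtype
  refine ⟨Set.range φ, Set.range_nonempty φ, ?_, fun X => ?_⟩
  · rintro _ ⟨P, rfl⟩ X hX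
    simp only [φ, linearPriceCLM_apply]
    exact linearPrice_nonneg hP (hAk P.2) (hZ P.1 P.2) hX
  · have h := hlub X
    rw [Set.image_eq_range] at h
    rw [← Set.range_comp]
    convert h using 2
    exact funext fun P => linearPriceCLM_apply hP (hAk P.2) (hZ P.1 P.2) X

end PriceSpace

/-! ### Sublinearity of suprema of linear functionals -/

section Sublinear

variable {E : Type*} [NormedAddCommGroup E] [NormedSpace ℝ E] {D : Set (E →L[ℝ] ℝ)} {Ψ : E → ℝ}

lemma apply_zero_of_isLUB (hD : D.Nonempty)
    (hΨ : ∀ X, IsLUB ((fun φ : E →L[ℝ] ℝ => φ X) '' D) (Ψ X)) : Ψ 0 = 0 := by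
  have h := hΨ 0
  simp only [map_zero, hD.image_const] at h
  exact h.unique isLUB_singleton

lemma apply_add_le_of_isLUB (hΨ : ∀ X, IsLUB ((fun φ : E →L[ℝ] ℝ => φ X) '' D) (Ψ X)) (X Y : E) :
    Ψ (X + Y) ≤ Ψ X + Ψ Y := by
  refine (hΨ _).2 ?_
  rintro _ ⟨φ, hφ, rfl⟩
  simp only [map_add]
  exact add_le_add ((hΨ X).1 ⟨φ, hφ, rfl⟩) ((hΨ Y).1 ⟨φ, hφ, rfl⟩)

lemma apply_smul_le_of_isLUB (hΨ : ∀ X, IsLUB ((fun φ : E →L[ℝ] ℝ => φ X) '' D) (Ψ X)) {c : ℝ}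
    (hc : 0 ≤ c) (X : E) : Ψ (c • X) ≤ c * Ψ X := by
  refine (hΨ _).2 ?_
  rintro _ ⟨φ, hφ, rfl⟩
  simp only [map_smul, smul_eq_mul]
  exact mul_le_mul_of_nonneg_left ((hΨ X).1 ⟨φ, hφ, rfl⟩) hc

end Sublinear

/-! ### A strictly positive functional below a coherent price -/

section StrictlyPositive

variable {Ω : Type*} [TopologicalSpace Ω] [PolishSpace Ω] [MeasurableSpace Ω] [BorelSpace Ω]
variable {𝓟 : Set (ProbabilityMeasure Ω)}

/-- A countable convex combination of functionals that are bounded above pointwise. -/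
lemma exists_countable_mixture {E : Type*} [NormedAddCommGroup E] [NormedSpace ℝ E]
    (φ : ℕ → E →L[ℝ] ℝ) {Ψ : E → ℝ} (hφ : ∀ n X, φ n X ≤ Ψ X) :
    ∃ χ : E →ₗ[ℝ] ℝ, ∀ X, HasSum (fun n => (1 / 2) * (1 / 2) ^ n * φ n X) (χ X) := by
  have hgeo : Summable fun n : ℕ => (1 / 2 : ℝ) * (1 / 2) ^ n :=
    (summable_geometric_of_lt_one (by norm_num) (by norm_num)).mul_left _
  have hs : ∀ X, Summable fun n => (1 / 2 : ℝ) * (1 / 2) ^ n * φ n X := fun X => by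
    -- An upper bound at `-X` is a lower bound at `X`, so the values `φ n X` are bounded in `n`.
    refine Summable.of_norm_bounded (hgeo.mul_right (max (Ψ X) (Ψ (-X)))) fun n => ?_
    rw [norm_mul, Real.norm_of_nonneg (by positivity : (0 : ℝ) ≤ 1 / 2 * (1 / 2) ^ n)]
    refine mul_le_mul_of_nonneg_left (abs_le'.2 ⟨(hφ n X).trans (le_max_left _ _), ?_⟩)
      (by positivity)
    rw [← map_neg]
    exact (hφ n (-X)).trans (le_max_right _ _)
  refine ⟨{ toFun := fun X => ∑' n, (1 / 2 : ℝ) * (1 / 2) ^ n * φ n X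
            map_add' := fun X Y => ?_
            map_smul' := fun c X => ?_ }, fun X => (hs X).hasSum⟩
  · rw [← (hs X).tsum_add (hs Y)]
    exact tsum_congr fun n => by rw [map_add, mul_add]
  · rw [RingHom.id_apply, smul_eq_mul, ← tsum_mul_left]
    exact tsum_congr fun n => by rw [map_smul, smul_eq_mul]; ring

/-- A countable dense part of the functionals defining `Ψ` is mixed with geometric weights of total
mass one, so the mixture stays below `Ψ`. If `Ψ X > 0`, some term of the sequence is positive at
`X`; the others are nonnegative when `X` is. -/
theorem exists_strictlyPositive_le (hP : IsCompact 𝓟) (hne : 𝓟.Nonempty) {Ψ : L2 𝓟 → ℝ}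
    (hΨ : Ψ ∈ strictlyPositivePrices 𝓟) :
    ∃ φ : L2 𝓟 →L[ℝ] ℝ, (∀ X, IsNonneg X → 0 ≤ φ X) ∧ (∀ X, IsStrictlyPos X → 0 < φ X) ∧
      ∀ X, φ X ≤ Ψ X := by
  obtain ⟨D, hD, hpos, hlub⟩ := exists_functionals_of_mem_priceSpace hP hΨ.1
  have := separableSpace_L2 hP hne
  obtain ⟨D', hD', hc, hdense⟩ := exists_countable_weakly_dense D
  have hne : D'.Nonempty := by
    obtain ⟨φ, hφ⟩ := hD
    obtain ⟨φ', hφ', -⟩ := hdense φ hφ 0 1 one_pos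
    exact ⟨φ', hφ'⟩
  obtain ⟨φ, rfl⟩ := hc.exists_eq_range hne
  have hφD : ∀ n, φ n ∈ D := fun n => hD' ⟨n, rfl⟩
  have hφΨ : ∀ n X, φ n X ≤ Ψ X := fun n X => (hlub X).1 ⟨_, hφD n, rfl⟩
  obtain ⟨χ, hχ⟩ := exists_countable_mixture φ hφΨ
  have hw : ∀ n : ℕ, (0 : ℝ) < 1 / 2 * (1 / 2) ^ n := fun n => by positivity
  have hterm : ∀ X, IsNonneg X → ∀ n, 0 ≤ (1 / 2 : ℝ) * (1 / 2) ^ n * φ n X := fun X hX n =>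
    mul_nonneg (hw n).le (hpos _ (hφD n) X hX)
  have hχpos : ∀ X, IsNonneg X → 0 ≤ χ X := fun X hX => (hχ X).nonneg (hterm X hX)
  refine ⟨⟨χ, continuous_of_nonneg hP χ hχpos⟩, hχpos, fun X hX => ?_, fun X => ?_⟩
  · obtain ⟨_, ⟨θ, hθ, rfl⟩, hθX⟩ := (lt_isLUB_iff (hlub X)).1 (hΨ.2 X hX)
    -- The tolerance is `θ X` itself, which keeps `φ n X` positive.
    obtain ⟨_, ⟨n, rfl⟩, hn⟩ := hdense θ hθ X _ hθX
    have h1 : 0 < φ n X := by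
      have := (abs_lt.1 hn).1
      simp only at hθX this
      linarith
    exact (mul_pos (hw n) h1).trans_le (le_hasSum (hχ X) n fun m _ => hterm X hX.1 m)
  · have h := (hasSum_geometric_of_lt_one (r := (1 / 2 : ℝ)) (by norm_num) (by norm_num)).mul_left
      (1 / 2 : ℝ)
    have h2 := h.mul_right (Ψ X)
    norm_num at h2
    refine hasSum_le (fun n => ?_) (hχ X) (by simpa using h2)
    have := mul_le_mul_of_nonneg_left (hφΨ n X) (hw n).le
    simpa using this

end StrictlyPositive

/-! ### Viability and strictly positive functionals -/

section Viability

variable {Ω : Type*} [TopologicalSpace Ω] [PolishSpace Ω] [MeasurableSpace Ω] [BorelSpace Ω]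
variable {𝓟 : Set (ProbabilityMeasure Ω)}

lemma isNonneg_zero (hP : IsCompact 𝓟) : IsNonneg (0 : L2 𝓟) := by
  rw [← map_zero (toL2 𝓟), isNonneg_toL2 hP]
  exact fun P _ => Filter.Eventually.of_forall fun ω => le_rfl

/-- By completeness one of two points is weakly worse; a convex combination is weakly preferred to
it, hence by transitivity strictly preferred to `a`. -/
lemma IsPreference.convex_strictUpper {pref : ℝ × L2 𝓟 → ℝ × L2 𝓟 → Prop}
    (hpref : IsPreference 𝓟 pref) (a : ℝ × L2 𝓟) : Convex ℝ {b | pref a b}ᶜ := by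
  have key : ∀ b c : ℝ × L2 𝓟, ¬ pref a b → pref c b → ∀ s t : ℝ, 0 ≤ s → 0 ≤ t → s + t = 1 →
      ¬ pref a (s • b + t • c) := fun b c hb hcb s t hs ht hst h => by
    have hbb : pref b b := (hpref.complete b b).elim id id
    exact hb (hpref.transitive _ _ _ h (hpref.convex b hbb hcb hs ht hst))
  intro b hb c hc s t hs ht hst
  rcases hpref.complete c b with h | h
  · exact key b c hb h s t hs ht hst
  · rw [add_comm]
    exact key c b hc h t s ht hs (by rwa [add_comm])

lemma convex_budget {𝕄 : Submodule ℝ (L2 𝓟)} {ψ : 𝕄 → ℝ}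
    (hadd : ∀ X Y, ψ (X + Y) ≤ ψ X + ψ Y) (hsmul : ∀ c : ℝ, 0 ≤ c → ∀ X, ψ (c • X) ≤ c * ψ X) :
    Convex ℝ {b : ℝ × L2 𝓟 | ∃ Y : 𝕄, b.2 = Y ∧ b.1 + ψ Y ≤ 0} := by
  rintro ⟨x, _⟩ ⟨X, rfl, hX⟩ ⟨y, _⟩ ⟨Y, rfl, hY⟩ s t hs ht -
  refine ⟨s • X + t • Y, rfl, ?_⟩
  have h1 := (hadd (s • X) (t • Y)).trans (add_le_add (hsmul s hs X) (hsmul t ht Y))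
  simp only [Prod.smul_mk, Prod.mk_add_mk, smul_eq_mul] at hX hY ⊢
  nlinarith [mul_le_mul_of_nonneg_left hX hs, mul_le_mul_of_nonneg_left hY ht]

/-- Sublinearity makes the budget set a convex cone; optimality makes it disjoint from the open
convex set of strictly preferred bundles. The separating functional, normalised by its value on the
numeraire, is `φ`. -/
theorem exists_functional_of_isViable (hP : IsCompact 𝓟) {𝕄 : Submodule ℝ (L2 𝓟)} {ψ : 𝕄 → ℝ}
    (h0 : ψ 0 = 0) (hadd : ∀ X Y, ψ (X + Y) ≤ ψ X + ψ Y)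
    (hsmul : ∀ c : ℝ, 0 ≤ c → ∀ X, ψ (c • X) ≤ c * ψ X) (hψ : IsViable ψ) :
    ∃ φ : L2 𝓟 →L[ℝ] ℝ, (∀ X, IsNonneg X → 0 ≤ φ X) ∧ (∀ X, IsStrictlyPos X → 0 < φ X) ∧
      ∀ Y : 𝕄, φ Y ≤ ψ Y := by
  obtain ⟨pref, hpref, a, ha, hopt⟩ := hψ
  have hbud : ∀ b : ℝ × 𝕄, b ∈ budgetSet 0 0 ψ ↔ b.1 + ψ b.2 ≤ 0 := fun b => by
    rw [budgetSet, Set.mem_ofPred_eq, h0, add_zero]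
  set â : ℝ × L2 𝓟 := (a.1, (a.2 : L2 𝓟)) with hâ
  set V := {b : ℝ × L2 𝓟 | ∃ Y : 𝕄, b.2 = Y ∧ b.1 + ψ Y ≤ 0} with hV
  have hdisj : Disjoint {b | pref â b}ᶜ V := by
    rw [Set.disjoint_left]
    rintro ⟨y, _⟩ hb ⟨Y, rfl, hY⟩
    exact hb (hopt (y, Y) ((hbud _).2 hY))
  obtain ⟨f, u, hfU, hfV⟩ := geometric_hahn_banach_open (hpref.convex_strictUpper â)
    (hpref.closed_lower â).isOpen_compl (convex_budget hadd hsmul) hdisj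
  have hU : ∀ (t : ℝ) (X : L2 𝓟), 0 ≤ t → IsNonneg X → (0 < t ∨ IsStrictlyPos X) →
      f (â + (t, X)) < u := fun t X ht hX h => hfU _ (hpref.strictMono â t X ht hX h).2
  have hâV : â ∈ V := ⟨a.2, rfl, (hbud a).1 ha⟩
  have h0V : (0 : ℝ × L2 𝓟) ∈ V := ⟨0, rfl, by simp [h0]⟩
  have h2V : (2 : ℝ) • â ∈ V := by
    refine ⟨(2 : ℝ) • a.2, rfl, ?_⟩
    have h1 := (hbud a).1 ha
    have h2 := hsmul 2 (by norm_num) a.2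
    simp only [hâ, Prod.smul_mk, smul_eq_mul]
    linarith
  -- The optimum is a limit of the strictly preferred bundles `â + (t, 0)`, `t > 0`. Since `0`, `â`
  -- and `2 • â` are all affordable, this forces `f â = 0` and `u = 0`.
  have hle : f â ≤ u := by
    refine le_of_forall_pos_le_add fun ε hε => ?_
    set k := |f (1, 0)| with hk
    have h1 := hU (ε / (k + 1)) 0 (by positivity) (isNonneg_zero hP) (Or.inl (by positivity))
    have h2 : ((ε / (k + 1), 0) : ℝ × L2 𝓟) = (ε / (k + 1)) • (1, 0) := by simp
    rw [map_add, h2, map_smul, smul_eq_mul] at h1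
    have h3 : -ε ≤ (ε / (k + 1)) * f (1, 0) := by
      have h4 : (ε / (k + 1)) * k ≤ ε := by
        rw [div_mul_eq_mul_div, div_le_iff₀ (by positivity)]
        nlinarith
      have h5 := mul_le_mul_of_nonneg_left (neg_abs_le (f (1, 0)))
        (by positivity : 0 ≤ ε / (k + 1))
      linarith
    linarith
  have hfâ : f â = 0 := by
    have h1 := hfV _ hâV
    have h2 := hfV _ h0V
    have h3 := hfV _ h2V
    rw [map_zero] at h2
    rw [map_smul, smul_eq_mul] at h3
    linarith
  have hu : u = 0 := by
    have h1 := hfV _ hâV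
    linarith
  subst hu
  have hneg : ∀ (t : ℝ) (X : L2 𝓟), 0 ≤ t → IsNonneg X → (0 < t ∨ IsStrictlyPos X) →
      f (t, X) < 0 := fun t X ht hX h => by
    have h1 := hU t X ht hX h
    rwa [map_add, hfâ, zero_add] at h1
  have hsplit : ∀ (t : ℝ) (X : L2 𝓟), f (t, X) = t * f (1, 0) + f (0, X) := fun t X => by
    rw [← smul_eq_mul, ← map_smul, ← map_add]
    simp
  have hl : f (1, 0) < 0 := hneg 1 0 zero_le_one (isNonneg_zero hP) (Or.inl one_pos)
  refine ⟨(f (1, 0))⁻¹ • f.comp (ContinuousLinearMap.inr ℝ ℝ (L2 𝓟)), fun X hX => ?_,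
    fun X hX => ?_, fun Y => ?_⟩
  · refine mul_nonneg_of_nonpos_of_nonpos (inv_nonpos.2 hl.le) ?_
    change f (0, X) ≤ 0
    refine le_of_forall_pos_le_add fun ε hε => ?_
    -- For `X` merely nonnegative, strictness requires some numeraire; this amount has `f`-value
    -- `-ε`.
    have h1 := hneg (ε / -f (1, 0)) X (div_nonneg hε.le (by linarith)) hX
      (Or.inl (div_pos hε (by linarith)))
    rw [hsplit, div_neg, neg_mul, div_mul_cancel₀ _ hl.ne] at h1
    linarith
  · exact mul_pos_of_neg_of_neg (inv_neg''.2 hl) (hneg 0 X le_rfl hX.1 (Or.inr hX))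
  -- Buying `Y` by selling its price exhausts the budget exactly.
  · have h1 := hfV (-ψ Y, (Y : L2 𝓟)) ⟨Y, rfl, by simp⟩
    rw [hsplit] at h1
    change (f (1, 0))⁻¹ * f (0, (Y : L2 𝓟)) ≤ ψ Y
    have h2 : f (1, 0) * ψ Y ≤ f (0, (Y : L2 𝓟)) := by linarith
    have h3 := mul_le_mul_of_nonpos_left h2 (inv_nonpos.2 hl.le)
    rwa [inv_mul_cancel_left₀ hl.ne] at h3

theorem isViable_of_functional {𝕄 : Submodule ℝ (L2 𝓟)} {ψ : 𝕄 → ℝ} (h0 : ψ 0 = 0)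
    (φ : L2 𝓟 →L[ℝ] ℝ) (hpos : ∀ X, IsNonneg X → 0 ≤ φ X)
    (hspos : ∀ X, IsStrictlyPos X → 0 < φ X) (hle : ∀ Y : 𝕄, φ Y ≤ ψ Y) : IsViable ψ := by
  refine ⟨fun a b => b.1 + φ b.2 ≤ a.1 + φ a.2,
    { complete := fun a b => le_total _ _
      transitive := fun a b c h1 h2 => h2.trans h1
      convex := fun a => ?_
      closed_upper := fun a => isClosed_le continuous_const (by fun_prop)
      closed_lower := fun a => isClosed_le (by fun_prop) continuous_const
      strictMono := fun a t X ht hX h => ?_ }, (0, 0), ?_, fun b hb => ?_⟩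
  · intro b hb c hc s t hs ht hst
    simp only [Set.mem_ofPred_eq, Prod.fst_add, Prod.smul_fst, Prod.snd_add, Prod.smul_snd,
      map_add, map_smul, smul_eq_mul] at hb hc ⊢
    have h1 : a.1 + φ a.2 = s * (a.1 + φ a.2) + t * (a.1 + φ a.2) := by
      rw [← add_mul, hst, one_mul]
    nlinarith [mul_le_mul_of_nonneg_left hb hs, mul_le_mul_of_nonneg_left hc ht]
  · have h1 : 0 < t + φ X := by
      rcases h with h | h
      · linarith [hpos X hX]
      · linarith [hspos X h]
    simp only [Prod.fst_add, Prod.snd_add, map_add, not_le]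
    constructor <;> linarith
  · simp [budgetSet]
  · rw [budgetSet, Set.mem_ofPred_eq, h0] at hb
    have h1 := hle b.2
    simp only [ZeroMemClass.coe_zero, map_zero]
    linarith

end Viability

/-! ### Consolidated prices -/

section Consolidation

variable {Ω : Type*} [TopologicalSpace Ω] [PolishSpace Ω] [MeasurableSpace Ω] [BorelSpace Ω]
variable {𝓟 : Set (ProbabilityMeasure Ω)}

/-- Densities are prescribed only at relevant priors; this makes the other priors negligible.
Compactness and metrizability of `𝓟` ensure that the support has full measure. -/
lemma support_mem_ae_of_isCompact (hP : IsCompact 𝓟) (μ : ProbabilityMeasure 𝓟) :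
    (μ : Measure 𝓟).support ∈ ae (μ : Measure 𝓟) := by
  have : CompactSpace 𝓟 := isCompact_iff_compactSpace.1 hP
  let : MetricSpace 𝓟 := TopologicalSpace.metrizableSpaceMetric 𝓟
  exact Measure.support_mem_ae

/-- A weighting of linear prices is a positive continuous linear functional. -/
lemma exists_functional_of_weighting (hP : IsCompact 𝓟) (μ : ProbabilityMeasure 𝓟)
    {Z : 𝓟 → Ω → ℝ} (hZ : ∀ P ∈ (μ : Measure 𝓟).support, IsDensity P.1 (Z P))
    (hint : ∀ X : L2 𝓟, Integrable (fun P : 𝓟 => linearPrice P.1 (Z P) X) (μ : Measure 𝓟)) :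
    ∃ φ : L2 𝓟 →L[ℝ] ℝ, (∀ X, φ X = ∫ P : 𝓟, linearPrice P.1 (Z P) X ∂(μ : Measure 𝓟)) ∧
      ∀ X, IsNonneg X → 0 ≤ φ X := by
  have hae := support_mem_ae_of_isCompact hP μ
  let χ : L2 𝓟 →ₗ[ℝ] ℝ :=
    { toFun := fun X => ∫ P : 𝓟, linearPrice P.1 (Z P) X ∂(μ : Measure 𝓟)
      map_add' := fun X Y => by
        rw [← integral_add (hint X) (hint Y)]
        refine integral_congr_ae ?_
        filter_upwards [hae] with P hPs
        simp only [← linearPriceCLM_apply hP (subset_closedHull P.2) (hZ P hPs), map_add]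
      map_smul' := fun c X => by
        rw [RingHom.id_apply, ← integral_smul]
        refine integral_congr_ae ?_
        filter_upwards [hae] with P hPs
        simp only [← linearPriceCLM_apply hP (subset_closedHull P.2) (hZ P hPs), map_smul] }
  have hχ : ∀ X, IsNonneg X → 0 ≤ χ X := fun X hX => by
    refine integral_nonneg_of_ae ?_
    filter_upwards [hae] with P hPs
    exact linearPrice_nonneg hP (subset_closedHull P.2) (hZ P hPs) hX
  -- Continuity comes from positivity alone; no bound on the norms of the densities, uniform in `P`,
  -- is needed.
  exact ⟨⟨χ, continuous_of_nonneg hP χ hχ⟩, fun _ => rfl, hχ⟩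

/-- A consolidated price is the restriction of a supremum of positive continuous functionals; if
there is only one prior, then all these functionals coincide. -/
lemma exists_functionals_of_isConsolidatedPrice (hP : IsCompact 𝓟) {E : Market 𝓟}
    {Γ : Consolidation 𝓟} {ψ : marketedSpace E Γ → ℝ} (hψ : IsConsolidatedPrice E Γ ψ) :
    ∃ (D : Set (L2 𝓟 →L[ℝ] ℝ)) (Ψ : L2 𝓟 → ℝ), D.Nonempty ∧
      (∀ φ ∈ D, ∀ X, IsNonneg X → 0 ≤ φ X) ∧
      (∀ X, IsLUB ((fun φ : L2 𝓟 →L[ℝ] ℝ => φ X) '' D) (Ψ X)) ∧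
      (∀ Y : marketedSpace E Γ, ψ Y = Ψ Y) ∧ (𝓟.Subsingleton → D.Subsingleton) := by
  obtain ⟨Z, Ψ, hZ, hmaps, hψΨ⟩ := hψ
  choose φ hφ hφpos using fun μ : Γ.weights => exists_functional_of_weighting hP μ.1
    (fun P hPs => (hZ P ⟨μ.1, μ.2, hPs⟩).1) fun X => (hmaps X).1 μ.1 μ.2
  have := Γ.nonempty.to_subtype
  refine ⟨Set.range φ, Ψ, Set.range_nonempty φ, ?_, fun X => ?_, hψΨ, fun hsub => ?_⟩
  · rintro _ ⟨μ, rfl⟩ X hX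
    exact hφpos μ X hX
  · have h := (hmaps X).2
    rw [Set.image_eq_range] at h
    rw [← Set.range_comp]
    convert h using 2
    exact funext fun μ => hφ μ X
  · have := Set.subsingleton_coe 𝓟 |>.2 hsub
    rintro _ ⟨μ, rfl⟩ _ ⟨ν, rfl⟩
    ext X
    obtain ⟨P₀⟩ := μ.1.nonempty
    have hconst : ∀ κ : ProbabilityMeasure 𝓟,
        ∫ P : 𝓟, linearPrice P.1 (Z P) X ∂(κ : Measure 𝓟) = linearPrice P₀.1 (Z P₀) X := fun κ => by
      have e : (fun P : 𝓟 => linearPrice P.1 (Z P) X) = fun _ => linearPrice P₀.1 (Z P₀) X :=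
        funext fun P => by rw [Subsingleton.elim P P₀]
      rw [e]
      simp
    rw [hφ, hφ, hconst, hconst]

end Consolidation

end ScenarioPricing

end

/-! ### The equivalence of viability and extension -/

theorem theorem1 {Ω : Type*} [TopologicalSpace Ω] [PolishSpace Ω] [MeasurableSpace Ω]
    [BorelSpace Ω] (𝓟 : Set (ProbabilityMeasure Ω)) (hP : IsCompact 𝓟)
    (E : ScenarioPricing.Market 𝓟) (Γ : ScenarioPricing.Consolidation 𝓟)
    (ψ : ScenarioPricing.marketedSpace E Γ → ℝ)
    (hψ : ScenarioPricing.IsConsolidatedPrice E Γ ψ) :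
    ScenarioPricing.IsViable ψ ↔
      ∃ Ψ ∈ ScenarioPricing.strictlyPositivePrices 𝓟,
        ∀ Y : ScenarioPricing.marketedSpace E Γ, Ψ (Y : ScenarioPricing.L2 𝓟) = ψ Y := by
  have hne : 𝓟.Nonempty := by
    obtain ⟨μ, -⟩ := Γ.nonempty
    obtain ⟨P⟩ := μ.nonempty
    exact ⟨P.1, P.2⟩
  obtain ⟨D, Ψ₀, hD, hDpos, hlub, hψΨ, hsub⟩ :=
    ScenarioPricing.exists_functionals_of_isConsolidatedPrice hP hψ
  have h0 : ψ 0 = 0 := by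
    rw [hψΨ]
    exact ScenarioPricing.apply_zero_of_isLUB hD hlub
  constructor
  · intro hviable
    obtain ⟨φ, hφpos, hφspos, hφle⟩ := ScenarioPricing.exists_functional_of_isViable hP h0
      (fun X Y => by
        simp only [hψΨ]
        exact ScenarioPricing.apply_add_le_of_isLUB hlub _ _)
      (fun c hc X => by
        simp only [hψΨ]
        exact ScenarioPricing.apply_smul_le_of_isLUB hlub hc _) hviable
    -- With one prior there is room for only one density, but then `ψ` is linear and `φ ≤ ψ` at `Y`
    -- and `-Y` gives equality.
    rcases 𝓟.subsingleton_or_nontrivial with hs | hnt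
    · obtain ⟨χ, hχ⟩ := hD
      have hψχ : ∀ Y : ScenarioPricing.marketedSpace E Γ, ψ Y = χ Y := fun Y => by
        have h := hlub (Y : ScenarioPricing.L2 𝓟)
        rw [(hsub hs).eq_singleton_of_mem hχ, Set.image_singleton] at h
        rw [hψΨ]
        exact h.unique isLUB_singleton
      obtain ⟨Q, hQ, Z, hZ, hQZ⟩ :=
        ScenarioPricing.representingPriors_nonempty hP hne φ hφpos
      refine ⟨φ, ⟨⟨{Q}, fun _ => Z, Set.singleton_nonempty Q, Set.singleton_subset_iff.2 hQ,
        fun P hPQ => ?_, fun X => ?_⟩, hφspos⟩, fun Y => ?_⟩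
      · rw [Set.mem_singleton_iff.1 hPQ]
        exact hZ
      · rw [Set.image_singleton, hQZ]
        exact isLUB_singleton
      · refine le_antisymm (hφle Y) ?_
        have h := hφle (-Y)
        rw [hψχ] at h ⊢
        simpa using h
    -- Adjoining `φ` to `D` adds strict positivity without changing the values on the marketed
    -- space, where `φ ≤ ψ`.
    · refine ⟨fun X => φ X ⊔ Ψ₀ X, ⟨ScenarioPricing.mem_priceSpace_of_isLUB hP hnt
        (D := insert φ D) (Set.insert_nonempty _ _) ?_ fun X => ?_, fun X hX => ?_⟩, fun Y => ?_⟩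
      · rintro _ (rfl | hχ)
        · exact hφpos
        · exact hDpos _ hχ
      · rw [Set.image_insert_eq]
        exact (hlub X).insert (φ X)
      · exact (hφspos X hX).trans_le le_sup_left
      · rw [hψΨ]
        exact sup_eq_right.2 (hψΨ Y ▸ hφle Y)
  · rintro ⟨Ψ, hΨ, hΨψ⟩
    obtain ⟨φ, hφpos, hφspos, hφle⟩ := ScenarioPricing.exists_strictlyPositive_le hP hne hΨ
    exact ScenarioPricing.isViable_of_functional h0 φ hφpos hφspos
      fun Y => (hφle Y).trans_eq (hΨψ Y)
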